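/- **Setting.** Let $1<\gamma<3$, $K>0$, $m\in\{1,2\}$, $b>0$. Consider the radially symmetric isentropic Euler equations $$(r^m\rho)_t+(r^m\rho u)_r=0,\qquad (r^m\rho u)_t+(r^m\rho u^2)_r+r^m p_r=0,\qquad p=K\rho^\gamma ,\qquad r>0,\ \rho\ge 0 .$$ Put $h=\sqrt{K\gamma}\,\rho^{(\gamma-1)/2}$, $c_1=u-h$, $c_2=u+h$, $\partial_i=\partial_t+c_i\partial_r$ and $$\alpha=-\frac{\partial_1(r^m\rho u)}{r^m\rho\, c_2},\qquad \beta=-\frac{\partial_2(r^m\rho u)}{r^m\rho\, c_1}.$$ A classical solution on $[0,T_0)$ is a pair $(\rho,u)$ that is $C^1$ (up to the initial line and the lateral boundary) on $\Omega=\{(r,t):0\le t<T_0,\ r\ge B(t)\}\subset\{r>0\}$ and satisfies the equations there, where $B(0)=b$ and $r=B(t)$ is the 2-characteristic, $B'=c_2(B,t)$, in Problem 1 (Cauchy problem on the domain of dependence of $[b,\infty)$), and the 1-characteristic, $B'=c_1(B,t)$, in Problem 2 (half Goursat problem). **Assumptions on the data.** Let $C_0\in\mathbb R$, $M_0>0$,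 $\bar\rho>0$. * Initial data: $0<\frac{2\sqrt{K\gamma}}{\gamma-1}\rho^{\frac{\gamma-1}2}(r,0)\le u(r,0)\le C_0$ for $r>b$; moreover $\rho(r,0)\ge\bar\rho$, $\alpha(r,0)<M_0$ and $\beta(r,0)<M_0$ for $r\ge b$. * For Problem 2 also, at $r=B(t)$ for $0\le t<T_0$: $0<\frac{2\sqrt{K\gamma}}{\gamma-1}\rho^{\frac{\gamma-1}2}\le u\le C_0$, $\rho\ge\bar\rho$ and $\alpha<M_0$. **Theorem.** Let $T>0$. 1. There is a constant $N=N(b,T)>0$, depending only on $b,T$ and $\gamma,K,m,C_0,M_0,\bar\rho$, such that singularity forms before time $T$, i.e. every classical solution on $[0,T_0)$ satisfying the assumptions has $T_0<T$, whenever * (Problem 1) $\alpha(r,0)\le -N$ for some $r\ge b$; or * (Problem 2) $\min\{\alpha(r,0),\beta(r,0)\}\le -N$ for some $r\ge b$. 2. For every $\delta>0$ there is a constant $N=N(b,T,\delta)>0$, depending only on $\delta$ and the quantities in 1, such that the same conclusion $T_0<T$ holds whenever * (Problem 1) $\beta(r,0)\le -N$ for some $r\ge b+\delta$; or * (Problem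 2) $\alpha(B(t),t)\le -N$ for some $t\in[0,T_0)$ with $t\le T-\delta$. -/

import Mathlib

open Set

namespace RadialEuler

noncomputable section

/-- The part of the `(r, t)`-plane with `0 ≤ t < T₀` that lies on or to the right of the curve
`r = B t`. -/
def region (B : ℝ → ℝ) (T₀ : ℝ) : Set (ℝ × ℝ) :=
  {p | 0 ≤ p.2 ∧ p.2 < T₀ ∧ B p.2 ≤ p.1}

/-- Partial derivative in `r` (one-sided on the boundary of `Ω`). -/
def dr (Ω : Set (ℝ × ℝ)) (f : ℝ × ℝ → ℝ) (p : ℝ × ℝ) : ℝ :=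
  fderivWithin ℝ f Ω p (1, 0)

/-- Partial derivative in `t` (one-sided on the boundary of `Ω`). -/
def dt (Ω : Set (ℝ × ℝ)) (f : ℝ × ℝ → ℝ) (p : ℝ × ℝ) : ℝ :=
  fderivWithin ℝ f Ω p (0, 1)

/-- The pressure law `p = K ρ ^ γ`. -/
def pressure (γ K : ℝ) (ρ : ℝ × ℝ → ℝ) (p : ℝ × ℝ) : ℝ :=
  K * ρ p ^ γ

/-- The sound speed `h = √(p_ρ) = √(K γ) ρ ^ ((γ - 1) / 2)`. -/
def soundSpeed (γ K : ℝ) (ρ : ℝ × ℝ → ℝ) (p : ℝ × ℝ) : ℝ :=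
  Real.sqrt (K * γ) * ρ p ^ ((γ - 1) / 2)

/-- The first characteristic speed `u - h`. -/
def c₁ (γ K : ℝ) (ρ u : ℝ × ℝ → ℝ) (p : ℝ × ℝ) : ℝ :=
  u p - soundSpeed γ K ρ p

/-- The second characteristic speed `u + h`. -/
def c₂ (γ K : ℝ) (ρ u : ℝ × ℝ → ℝ) (p : ℝ × ℝ) : ℝ :=
  u p + soundSpeed γ K ρ p

/-- The radial mass flux `r ^ m ρ u`, which is constant in stationary flows. -/
def massFlux (m : ℕ) (ρ u : ℝ × ℝ → ℝ) (p : ℝ × ℝ) : ℝ :=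
  p.1 ^ m * ρ p * u p

/-- The gradient variable `α = - ∂₁ (r ^ m ρ u) / (r ^ m ρ c₂)` with `∂₁ = ∂ₜ + c₁ ∂ᵣ`. -/
def alpha (γ K : ℝ) (m : ℕ) (Ω : Set (ℝ × ℝ)) (ρ u : ℝ × ℝ → ℝ) (p : ℝ × ℝ) : ℝ :=
  -(dt Ω (massFlux m ρ u) p + c₁ γ K ρ u p * dr Ω (massFlux m ρ u) p) /
    (p.1 ^ m * ρ p * c₂ γ K ρ u p)

/-- The gradient variable `β = - ∂₂ (r ^ m ρ u) / (r ^ m ρ c₁)` with `∂₂ = ∂ₜ + c₂ ∂ᵣ`. -/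
def beta (γ K : ℝ) (m : ℕ) (Ω : Set (ℝ × ℝ)) (ρ u : ℝ × ℝ → ℝ) (p : ℝ × ℝ) : ℝ :=
  -(dt Ω (massFlux m ρ u) p + c₂ γ K ρ u p * dr Ω (massFlux m ρ u) p) /
    (p.1 ^ m * ρ p * c₁ γ K ρ u p)

/-- A classical (that is, `C¹` up to the initial line and the lateral boundary) solution `(ρ, u)`
of the radially symmetric isentropic Euler equations on `Ω ⊆ {r > 0}`, with nonnegative density. -/
structure IsClassicalSolution (γ K : ℝ) (m : ℕ) (Ω : Set (ℝ × ℝ)) (ρ u : ℝ × ℝ → ℝ) :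
    Prop where
  radius_pos : ∀ p ∈ Ω, 0 < p.1
  contDiffOn_density : ContDiffOn ℝ 1 ρ Ω
  contDiffOn_velocity : ContDiffOn ℝ 1 u Ω
  density_nonneg : ∀ p ∈ Ω, 0 ≤ ρ p
  mass : ∀ p ∈ Ω,
    dt Ω (fun q => q.1 ^ m * ρ q) p + dr Ω (fun q => q.1 ^ m * ρ q * u q) p = 0
  momentum : ∀ p ∈ Ω,
    dt Ω (fun q => q.1 ^ m * ρ q * u q) p + dr Ω (fun q => q.1 ^ m * ρ q * u q ^ 2) p
      + p.1 ^ m * dr Ω (pressure γ K ρ) p = 0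

/-- A classical solution on `0 ≤ t < T₀` of Problem 1 (Cauchy problem): the domain is bounded on
the left by the 2-characteristic `r = B t` that starts at `(b, 0)`. -/
structure IsSolutionProblem1 (γ K : ℝ) (m : ℕ) (b T₀ : ℝ) (B : ℝ → ℝ) (ρ u : ℝ × ℝ → ℝ) :
    Prop where
  solution : IsClassicalSolution γ K m (region B T₀) ρ u
  start : B 0 = b
  characteristic : ∀ t ∈ Ico 0 T₀,
    HasDerivWithinAt B (c₂ γ K ρ u (B t, t)) (Ico 0 T₀) t

/-- A classical solution on `0 ≤ t < T₀` of Problem 2 (half Goursat problem): the domain is bounded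
on the left by the 1-characteristic `r = B t` that starts at `(b, 0)`. -/
structure IsSolutionProblem2 (γ K : ℝ) (m : ℕ) (b T₀ : ℝ) (B : ℝ → ℝ) (ρ u : ℝ × ℝ → ℝ) :
    Prop where
  solution : IsClassicalSolution γ K m (region B T₀) ρ u
  start : B 0 = b
  characteristic : ∀ t ∈ Ico 0 T₀,
    HasDerivWithinAt B (c₁ γ K ρ u (B t, t)) (Ico 0 T₀) t

/-- The state at the point `p` satisfies `0 < 2 √(K γ) / (γ - 1) ρ ^ ((γ - 1) / 2) ≤ u ≤ C₀`. -/
def StateBound (γ K C₀ : ℝ) (ρ u : ℝ × ℝ → ℝ) (p : ℝ × ℝ) : Prop :=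
  0 < 2 * Real.sqrt (K * γ) / (γ - 1) * ρ p ^ ((γ - 1) / 2) ∧
    2 * Real.sqrt (K * γ) / (γ - 1) * ρ p ^ ((γ - 1) / 2) ≤ u p ∧ u p ≤ C₀

/-- The hypotheses on the initial data on `[b, ∞)`: the bounds on the state, the lower bound
`ρlow` of the density, and the upper bound `M₀` of the gradient variables. -/
structure InitialHypotheses (γ K : ℝ) (m : ℕ) (b C₀ M₀ ρlow : ℝ) (Ω : Set (ℝ × ℝ))
    (ρ u : ℝ × ℝ → ℝ) : Prop where
  state : ∀ r, b < r → StateBound γ K C₀ ρ u (r, 0)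
  density : ∀ r, b ≤ r → ρlow ≤ ρ (r, 0)
  alpha_lt : ∀ r, b ≤ r → alpha γ K m Ω ρ u (r, 0) < M₀
  beta_lt : ∀ r, b ≤ r → beta γ K m Ω ρ u (r, 0) < M₀

/-- The hypotheses on the data along the lateral boundary `r = B t`, `0 ≤ t < T₀`. -/
structure BoundaryHypotheses (γ K : ℝ) (m : ℕ) (C₀ M₀ ρlow T₀ : ℝ) (B : ℝ → ℝ)
    (Ω : Set (ℝ × ℝ)) (ρ u : ℝ × ℝ → ℝ) : Prop where
  state : ∀ t ∈ Ico 0 T₀, StateBound γ K C₀ ρ u (B t, t)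
  density : ∀ t ∈ Ico 0 T₀, ρlow ≤ ρ (B t, t)
  alpha_lt : ∀ t ∈ Ico 0 T₀, alpha γ K m Ω ρ u (B t, t) < M₀

end

end RadialEuler

/-!
In the Riemann invariants `w = u + 2 h / (γ - 1)` and `z = u - 2 h / (γ - 1)` the Euler equations
become a diagonal system that is symmetric in `w` and `z`,
`w_t + c₂ w_r = - κ (w² - z²) / r` and `z_t + c₁ z_r = - κ (z² - w²) / r`, where
`c₂ = a w + b z`, `c₁ = a z + b w`, `a = (γ + 1) / 4`, `b = (3 - γ) / 4`, `κ = m (γ - 1) / 8`. The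
gradient variables are `α = - w_t / c₂` and `β = - z_t / c₁`. Along the fast characteristics `α`
satisfies a Riccati equation with the quadratic terms `- a α² - b α β`; the product `α β` disappears
for the weighted variables `(w - z) ^ (-b / (a - b)) α` and `(w - z) ^ (-b / (a - b)) β`, and what
remains is a quadratic term with the good sign, a bounded multiple of the variable itself and a
bounded *nonnegative* multiple of the other one. The same holds for `β` along the slow
characteristics (`IsDiagonalSolution.hasDerivAt_wgrad`, stated once for both families).

* Since the coefficient of the other variable is nonnegative, the maximum of the two weighted
  variables grows at most exponentially (`IsAdmissible.wgrad_le`).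
* An upper bound on `β` bounds from above the rate at which `log (w - z)` decreases along fast
  characteristics, so that the density has a positive lower bound up to time `T`
  (`IsAdmissible.log_sub_ge`). Hence the coefficient of the quadratic term is bounded away from `0`.
* A sufficiently negative `α` or `β` therefore tends to `-∞` within any prescribed time `η`, if its
  characteristic stays in the domain that long (`exists_threshold`). Fast characteristics and, in
  Problem 2, slow ones never leave the domain; a slow characteristic of Problem 1 that starts at
  distance `δ` from the corner stays for a time proportional to `δ`. These are the two kinds of
  thresholds in the theorem.

Three points need care. The solution is only `C¹`, so that the Riccati equation, which involves second
derivatives of `ρ` and `u`, is obtained from difference quotients in time along a characteristic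
(`IsDiagonalSolution.hasDerivAt_dt`). The bounds `ρ > 0` and `z ≥ 0`, which are assumed on the data
only and which make both speeds positive, are propagated by a barrier argument on compact
trapezoids (`barrier`). The domain is unbounded and the solution is not assumed to be bounded for
`t > 0`; but backward characteristics run to the left, hence all maximum principles can be applied
on the trapezoid to the left of and below a given point (`le_of_exists_gt`).
-/

namespace RadialEuler

noncomputable section

open Filter Topology

/-! ### Paths, characteristics and the geometry of the domain -/

theorem hasDerivWithinAt_comp_path {Ω : Set (ℝ × ℝ)} {f : ℝ × ℝ → ℝ} {X Y : ℝ → ℝ} {v t : ℝ}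
    {s : Set ℝ} (hf : DifferentiableWithinAt ℝ f Ω (X t, Y t)) (hX : HasDerivWithinAt X v s t)
    (hY : HasDerivWithinAt Y 1 s t) (hmem : ∀ t ∈ s, (X t, Y t) ∈ Ω) :
    HasDerivWithinAt (fun t => f (X t, Y t))
      (dt Ω f (X t, Y t) + v * dr Ω f (X t, Y t)) s t := by
  have h := (hf.hasFDerivWithinAt).comp_hasDerivWithinAt (f := fun t => (X t, Y t)) t
    (hX.prodMk hY) hmem
  have e : (fderivWithin ℝ f Ω (X t, Y t)) (v, 1)
      = dt Ω f (X t, Y t) + v * dr Ω f (X t, Y t) := by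
    have : ((v, 1) : ℝ × ℝ) = (0, 1) + v • ((1, 0) : ℝ × ℝ) := by simp
    rw [this, map_add, map_smul]; rfl
  rw [e] at h
  exact h

/-- The curve `r = X t`, `t₁ ≤ t ≤ t₂`, stays in `Ω` and has speed `c`. -/
structure IsCharacteristic (c : ℝ × ℝ → ℝ) (Ω : Set (ℝ × ℝ)) (X : ℝ → ℝ) (t₁ t₂ : ℝ) :
    Prop where
  mem : ∀ t ∈ Icc t₁ t₂, (X t, t) ∈ Ω
  deriv : ∀ t ∈ Icc t₁ t₂, HasDerivWithinAt X (c (X t, t)) (Icc t₁ t₂) t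

namespace IsCharacteristic

variable {c f : ℝ × ℝ → ℝ} {Ω : Set (ℝ × ℝ)} {X : ℝ → ℝ} {t₁ t₂ : ℝ}

theorem continuousOn (h : IsCharacteristic c Ω X t₁ t₂) : ContinuousOn X (Icc t₁ t₂) :=
  fun t ht => (h.deriv t ht).continuousWithinAt

theorem continuousOn_comp (h : IsCharacteristic c Ω X t₁ t₂) (hf : ContinuousOn f Ω) :
    ContinuousOn (fun t => f (X t, t)) (Icc t₁ t₂) :=
  hf.comp (h.continuousOn.prodMk continuousOn_id) h.mem

theorem hasDerivWithinAt_comp (h : IsCharacteristic c Ω X t₁ t₂)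
    (hf : ContDiffOn ℝ 1 f Ω) {t : ℝ} (ht : t ∈ Icc t₁ t₂) :
    HasDerivWithinAt (fun t => f (X t, t))
      (dt Ω f (X t, t) + c (X t, t) * dr Ω f (X t, t)) (Icc t₁ t₂) t :=
  hasDerivWithinAt_comp_path (Y := fun t => t)
    ((hf.differentiableOn one_ne_zero) _ (h.mem t ht)) (h.deriv t ht)
    (hasDerivWithinAt_id t _) h.mem

theorem hasDerivAt_comp (h : IsCharacteristic c Ω X t₁ t₂)
    (hf : ContDiffOn ℝ 1 f Ω) {t : ℝ} (ht : t ∈ Ioo t₁ t₂) :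
    HasDerivAt (fun t => f (X t, t))
      (dt Ω f (X t, t) + c (X t, t) * dr Ω f (X t, t)) t :=
  (h.hasDerivWithinAt_comp hf (Ioo_subset_Icc_self ht)).hasDerivAt (Icc_mem_nhds ht.1 ht.2)

theorem mono (h : IsCharacteristic c Ω X t₁ t₂) {s₁ s₂ : ℝ} (h₁ : t₁ ≤ s₁) (h₂ : s₂ ≤ t₂) :
    IsCharacteristic c Ω X s₁ s₂ :=
  ⟨fun t ht => h.mem t (Icc_subset_Icc h₁ h₂ ht),
    fun t ht => (h.deriv t (Icc_subset_Icc h₁ h₂ ht)).mono (Icc_subset_Icc h₁ h₂)⟩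

end IsCharacteristic

theorem continuousOn_dt {Ω : Set (ℝ × ℝ)} {f : ℝ × ℝ → ℝ} (hΩ : UniqueDiffOn ℝ Ω)
    (hf : ContDiffOn ℝ 1 f Ω) : ContinuousOn (dt Ω f) Ω :=
  (hf.continuousOn_fderivWithin hΩ le_rfl).clm_apply continuousOn_const

theorem continuousOn_dr {Ω : Set (ℝ × ℝ)} {f : ℝ × ℝ → ℝ} (hΩ : UniqueDiffOn ℝ Ω)
    (hf : ContDiffOn ℝ 1 f Ω) : ContinuousOn (dr Ω f) Ω :=
  (hf.continuousOn_fderivWithin hΩ le_rfl).clm_apply continuousOn_const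

/-- At each point of the region the tangent cone contains `(1, 0)` and a vector `(v, 1)`, where
`v` exceeds the speed of the lateral boundary. -/
theorem uniqueDiffOn_region {B B' : ℝ → ℝ} {T₀ : ℝ}
    (hB : ∀ t ∈ Ico 0 T₀, HasDerivWithinAt B (B' t) (Ico 0 T₀) t) :
    UniqueDiffOn ℝ (region B T₀) := by
  rintro ⟨r, t⟩ ⟨h0, hT, hr⟩
  simp only at h0 hT hr
  refine ⟨?_, subset_closure ⟨h0, hT, hr⟩⟩
  have h1 : ((1, 0) : ℝ × ℝ) ∈ tangentConeAt ℝ (region B T₀) (r, t) := by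
    have := mem_tangentConeAt_of_segment_subset (s := region B T₀) (x := (r, t)) (y := (r + 1, t))
      (by
        intro p hp
        rw [segment_eq_image'] at hp
        obtain ⟨θ, hθ, rfl⟩ := hp
        refine ⟨by simpa using h0, by simpa using hT, ?_⟩
        simp only [Prod.mk_sub_mk, add_sub_cancel_left, sub_self, Prod.smul_mk, smul_eq_mul,
          mul_one, mul_zero, Prod.mk_add_mk, add_zero]
        linarith [hθ.1])
    simpa using this
  have h2 : ∃ v : ℝ, ∃ s : ℝ, 0 < s ∧
      ((s * v, s) : ℝ × ℝ) ∈ tangentConeAt ℝ (region B T₀) (r, t) := by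
    have hd := hB t ⟨h0, hT⟩
    rw [hasDerivWithinAt_iff_tendsto_slope] at hd
    have hev := hd.eventually (gt_mem_nhds (lt_add_one (B' t)))
    rw [eventually_nhdsWithin_iff, Metric.eventually_nhds_iff] at hev
    obtain ⟨ε, hε, hev⟩ := hev
    set s := min (ε / 2) ((T₀ - t) / 2) with hs
    have hs0 : 0 < s := lt_min (by linarith) (by linarith)
    refine ⟨B' t + 1, s, hs0, ?_⟩
    have := mem_tangentConeAt_of_segment_subset (s := region B T₀) (x := (r, t))
      (y := (r + s * (B' t + 1), t + s))
      (by
        intro p hp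
        rw [segment_eq_image'] at hp
        obtain ⟨θ, hθ, rfl⟩ := hp
        have e1 : s ≤ ε / 2 := min_le_left _ _
        have e2 : s ≤ (T₀ - t) / 2 := min_le_right _ _
        have e3 : 0 ≤ θ * s := mul_nonneg hθ.1 hs0.le
        have e4 : θ * s ≤ s := by nlinarith [hθ.2]
        simp only [Prod.mk_sub_mk, add_sub_cancel_left, Prod.smul_mk, smul_eq_mul,
          Prod.mk_add_mk]
        refine ⟨by simp only; linarith, by simp only; linarith, ?_⟩
        simp only
        rcases e3.eq_or_lt with e | e
        · rw [← e, ← mul_assoc, ← e]; simpa using hr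
        · have := hev (y := t + θ * s) (by rw [Real.dist_eq]; simp [abs_of_pos e]; linarith)
            ⟨⟨by linarith, by linarith⟩, by simp [e.ne']⟩
          rw [slope_def_field, div_lt_iff₀ (by linarith)] at this
          linarith [this, mul_assoc θ s (B' t + 1)])
    simpa using this
  obtain ⟨v, s, hs, h2⟩ := h2
  have htop : Submodule.span ℝ (tangentConeAt ℝ (region B T₀) (r, t)) = ⊤ := by
    rw [eq_top_iff]
    rintro ⟨x, y⟩ -
    have : ((x, y) : ℝ × ℝ) = (x - y * v) • ((1, 0) : ℝ × ℝ) + (y / s) • ((s * v, s) : ℝ × ℝ) := by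
      ext
      · simp; field_simp; ring
      · simp; field_simp
    rw [this]
    exact Submodule.add_mem _ (Submodule.smul_mem _ _ (Submodule.subset_span h1))
      (Submodule.smul_mem _ _ (Submodule.subset_span h2))
  rw [htop]
  exact dense_univ

/-- The compact part `0 ≤ t ≤ τ`, `B t ≤ r ≤ R` of the domain. -/
def trapezoid (B : ℝ → ℝ) (τ R : ℝ) : Set (ℝ × ℝ) :=
  {p | 0 ≤ p.2 ∧ p.2 ≤ τ ∧ B p.2 ≤ p.1 ∧ p.1 ≤ R}

theorem isCompact_trapezoid {B : ℝ → ℝ} {τ : ℝ} (R : ℝ) (hB : ContinuousOn B (Icc 0 τ)) :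
    IsCompact (trapezoid B τ R) := by
  obtain ⟨M, hM⟩ := (isCompact_Icc.image_of_continuousOn hB).bddBelow
  have hcl : IsClosed {p : ℝ × ℝ | p ∈ Icc M R ×ˢ Icc 0 τ ∧ B p.2 ≤ p.1} :=
    IsClosed.isClosed_le (isClosed_Icc.prod isClosed_Icc)
      (hB.comp continuousOn_snd fun p hp => hp.2) continuousOn_fst
  refine ((isCompact_Icc.prod isCompact_Icc).of_isClosed_subset hcl fun p hp => hp.1 :
    IsCompact {p : ℝ × ℝ | p ∈ Icc M R ×ˢ Icc 0 τ ∧ B p.2 ≤ p.1}).of_isClosed_subset ?_ ?_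
  · have : trapezoid B τ R = {p : ℝ × ℝ | p ∈ Icc M R ×ˢ Icc 0 τ ∧ B p.2 ≤ p.1} := by
      ext ⟨r, t⟩
      constructor
      · rintro ⟨h1, h2, h3, h4⟩
        exact ⟨⟨⟨(hM ⟨t, ⟨h1, h2⟩, rfl⟩).trans h3, h4⟩, h1, h2⟩, h3⟩
      · rintro ⟨⟨⟨h1, h2⟩, h3, h4⟩, h5⟩
        exact ⟨h3, h4, h5, h2⟩
    rw [this]; exact hcl
  · rintro ⟨r, t⟩ ⟨h1, h2, h3, h4⟩
    exact ⟨⟨⟨(hM ⟨t, ⟨h1, h2⟩, rfl⟩).trans h3, h4⟩, h1, h2⟩, h3⟩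

theorem trapezoid_subset_region {B : ℝ → ℝ} {τ R T₀ : ℝ} (h : τ < T₀) :
    trapezoid B τ R ⊆ region B T₀ :=
  fun _ hp => ⟨hp.1, hp.2.1.trans_lt h, hp.2.2.1⟩

/-! ### Scalar differential inequalities -/

theorem exists_gt_of_hasDerivAt_neg {f f' : ℝ → ℝ} {t₁ t₀ : ℝ} (ht : t₁ < t₀)
    (hc : ContinuousOn f (Icc t₁ t₀)) (hd : ∀ t ∈ Ioo t₁ t₀, HasDerivAt f (f' t) t)
    (hc' : ContinuousOn f' (Icc t₁ t₀)) (hneg : f' t₀ < 0) : ∃ t ∈ Icc t₁ t₀, f t₀ < f t := by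
  have hev := (hc' t₀ (right_mem_Icc.2 ht.le)).eventually (gt_mem_nhds hneg)
  rw [eventually_nhdsWithin_iff, Metric.eventually_nhds_iff] at hev
  obtain ⟨ε, hε, hev⟩ := hev
  set s := max t₁ (t₀ - ε / 2) with hs
  have hs1 : t₁ ≤ s := le_max_left _ _
  have hs2 : t₀ - ε / 2 ≤ s := le_max_right _ _
  have hs3 : s < t₀ := max_lt ht (by linarith)
  have hanti : StrictAntiOn f (Icc s t₀) := by
    refine strictAntiOn_of_deriv_neg (convex_Icc _ _) (hc.mono (Icc_subset_Icc_left hs1)) ?_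
    intro x hx
    rw [interior_Icc] at hx
    rw [(hd x ⟨hs1.trans_lt hx.1, hx.2⟩).deriv]
    refine hev (y := x) ?_ ⟨(hs1.trans_lt hx.1).le, hx.2.le⟩
    rw [Real.dist_eq, abs_lt]
    constructor <;> linarith [hx.1, hx.2]
  exact ⟨s, ⟨hs1, hs3.le⟩, hanti (left_mem_Icc.2 hs3.le) (right_mem_Icc.2 hs3.le) hs3⟩

/-- A function that grows at a nonnegative rate wherever it is negative, stays nonnegative. -/
theorem nonneg_of_deriv_nonneg_of_neg {f f' : ℝ → ℝ} {t₁ t₂ : ℝ}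
    (hd : ∀ t ∈ Icc t₁ t₂, HasDerivWithinAt f (f' t) (Icc t₁ t₂) t)
    (h : ∀ t ∈ Icc t₁ t₂, f t < 0 → 0 ≤ f' t) (h₁ : 0 ≤ f t₁) :
    ∀ t ∈ Icc t₁ t₂, 0 ≤ f t := by
  intro t ht
  by_contra! hlt
  have hc : ContinuousOn f (Icc t₁ t₂) := fun t ht => (hd t ht).continuousWithinAt
  have hsub : Icc t₁ t ⊆ Icc t₁ t₂ := Icc_subset_Icc_right ht.2
  -- the last time before `t` at which `f` is nonnegative
  have hcl : IsClosed {s | s ∈ Icc t₁ t ∧ 0 ≤ f s} :=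
    IsClosed.isClosed_le isClosed_Icc continuousOn_const (hc.mono hsub)
  have hcp : IsCompact {s | s ∈ Icc t₁ t ∧ 0 ≤ f s} :=
    isCompact_Icc.of_isClosed_subset hcl fun s hs => hs.1
  obtain ⟨s, ⟨hs, hfs⟩, hmax⟩ := hcp.exists_isMaxOn ⟨t₁, ⟨⟨le_rfl, ht.1⟩, h₁⟩⟩ continuousOn_id
  have hst : s < t := lt_of_le_of_ne hs.2 (by rintro rfl; linarith)
  have hneg : ∀ x ∈ Ioc s t, f x < 0 := by
    intro x hx
    by_contra! hx0
    have : x ≤ s := hmax (a := x) ⟨⟨hs.1.trans hx.1.le, hx.2⟩, hx0⟩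
    linarith [hx.1]
  have hmono : MonotoneOn f (Icc s t) := by
    have hsub' : Icc s t ⊆ Icc t₁ t₂ := Icc_subset_Icc hs.1 ht.2
    have hda : ∀ x ∈ Ioo s t, HasDerivAt f (f' x) x := fun x hx =>
      (hd x (hsub' (Ioo_subset_Icc_self hx))).hasDerivAt
        (Icc_mem_nhds (hs.1.trans_lt hx.1) (hx.2.trans_le ht.2))
    refine monotoneOn_of_deriv_nonneg (convex_Icc _ _) (hc.mono hsub') ?_ ?_
    · intro x hx
      rw [interior_Icc] at hx
      exact (hda x hx).differentiableAt.differentiableWithinAt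
    · intro x hx
      rw [interior_Icc] at hx
      rw [(hda x hx).deriv]
      exact h x (hsub' (Ioo_subset_Icc_self hx)) (hneg x (Ioo_subset_Ioc_self hx))
  have := hmono (left_mem_Icc.2 hst.le) (right_mem_Icc.2 hst.le) hst.le
  linarith

/-- Finite-time blow-up for `f' ≥ c f ^ 2`: the reciprocal of `f` decreases at rate at least `c`,
so that it vanishes within time `1 / (c f(t₁))`. -/
theorem false_of_riccati {f f' : ℝ → ℝ} {t₁ t₂ c N : ℝ} (ht : t₁ < t₂)
    (hc : ContinuousOn f (Icc t₁ t₂)) (hd : ∀ t ∈ Ioo t₁ t₂, HasDerivAt f (f' t) t)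
    (h : ∀ t ∈ Ioo t₁ t₂, N ≤ f t → c * f t ^ 2 ≤ f' t) (hc0 : 0 < c) (hN : 0 < N)
    (h₁ : N < f t₁) (hbig : 1 < c * (t₂ - t₁) * f t₁) : False := by
  have hcl : IsClosed {s | s ∈ Icc t₁ t₂ ∧ f s ≤ N} :=
    IsClosed.isClosed_le isClosed_Icc hc continuousOn_const
  have hcp : IsCompact {s | s ∈ Icc t₁ t₂ ∧ f s ≤ N} :=
    isCompact_Icc.of_isClosed_subset hcl fun s hs => hs.1
  -- as long as `f > N`, the function increases
  have hmono : ∀ s ∈ Icc t₁ t₂, (∀ x ∈ Ioo t₁ s, N < f x) → MonotoneOn f (Icc t₁ s) := by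
    intro s hs hx
    refine monotoneOn_of_deriv_nonneg (convex_Icc _ _) (hc.mono (Icc_subset_Icc_right hs.2)) ?_ ?_
    · intro x hx'
      rw [interior_Icc] at hx'
      exact (hd x ⟨hx'.1, hx'.2.trans_le hs.2⟩).differentiableAt.differentiableWithinAt
    · intro x hx'
      rw [interior_Icc] at hx'
      have hxt : x ∈ Ioo t₁ t₂ := ⟨hx'.1, hx'.2.trans_le hs.2⟩
      rw [(hd x hxt).deriv]
      exact le_trans (by positivity) (h x hxt (hx x hx').le)
  have hall : ∀ s ∈ Icc t₁ t₂, N < f s := by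
    by_contra! hne
    obtain ⟨s₀, hs₀, hfs₀⟩ := hne
    obtain ⟨s, ⟨hs, hfs⟩, hmin⟩ := hcp.exists_isMinOn ⟨s₀, hs₀, hfs₀⟩ continuousOn_id
    have := hmono s hs (fun x hx => by
      by_contra! hx0
      have : s ≤ x := hmin (a := x) ⟨⟨hx.1.le, hx.2.le.trans hs.2⟩, hx0⟩
      linarith [hx.2]) (left_mem_Icc.2 hs.1) (right_mem_Icc.2 hs.1) hs.1
    linarith
  have hanti : AntitoneOn (fun t => (f t)⁻¹ + c * t) (Icc t₁ t₂) := by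
    have hda : ∀ x ∈ Ioo t₁ t₂,
        HasDerivAt (fun t => (f t)⁻¹ + c * t) (-f' x / f x ^ 2 + c) x := by
      intro x hx
      exact (((hd x hx).inv (hN.trans (hall x (Ioo_subset_Icc_self hx))).ne').add
        ((hasDerivAt_id x).const_mul c)).congr_deriv (by simp)
    refine antitoneOn_of_deriv_nonpos (convex_Icc _ _) ?_ ?_ ?_
    · exact (hc.inv₀ fun x hx => (hN.trans (hall x hx)).ne').add
        (continuousOn_const.mul continuousOn_id)
    · intro x hx
      rw [interior_Icc] at hx
      exact (hda x hx).differentiableAt.differentiableWithinAt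
    · intro x hx
      rw [interior_Icc] at hx
      rw [(hda x hx).deriv]
      have hpos := hN.trans (hall x (Ioo_subset_Icc_self hx))
      have := h x hx (hall x (Ioo_subset_Icc_self hx)).le
      rw [neg_div, neg_add_nonpos_iff, le_div_iff₀ (by positivity)]
      exact this
  have hfin := hanti (left_mem_Icc.2 ht.le) (right_mem_Icc.2 ht.le) ht.le
  simp only at hfin
  have h2 : 0 < (f t₂)⁻¹ := inv_pos.2 (hN.trans (hall t₂ (right_mem_Icc.2 ht.le)))
  have h3 : (f t₁)⁻¹ < c * (t₂ - t₁) := by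
    rw [inv_lt_iff_one_lt_mul₀ (hN.trans h₁)]; linarith
  linarith

/-! ### Time derivatives along characteristics -/

/-- A `C¹` solution `(p, q)` of the diagonal system
`p_t + (a p + b q) p_r = - κ (p² - q²) / r`, `q_t + (a q + b p) q_r = - κ (q² - p²) / r`
on a domain that contains the vertical segments down to the initial line. The system is invariant
under the exchange of `p` and `q`, so that a statement about one family of characteristics holds
for the other one too. -/
structure IsDiagonalSolution (a b κ : ℝ) (Ω : Set (ℝ × ℝ)) (p q : ℝ × ℝ → ℝ) : Prop where
  radius_pos : ∀ x ∈ Ω, 0 < x.1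
  uniqueDiffOn : UniqueDiffOn ℝ Ω
  backward : ∀ r s t, (r, t) ∈ Ω → 0 ≤ s → s ≤ t → (r, s) ∈ Ω
  contDiffOn_left : ContDiffOn ℝ 1 p Ω
  contDiffOn_right : ContDiffOn ℝ 1 q Ω
  eq_left : ∀ x ∈ Ω,
    dt Ω p x + (a * p x + b * q x) * dr Ω p x = -(κ * (p x ^ 2 - q x ^ 2) / x.1)
  eq_right : ∀ x ∈ Ω,
    dt Ω q x + (a * q x + b * p x) * dr Ω q x = -(κ * (q x ^ 2 - p x ^ 2) / x.1)

theorem tendsto_backward_quotient {Ω : Set (ℝ × ℝ)} {f : ℝ × ℝ → ℝ} {r t : ℝ} (ht : 0 < t)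
    (hf : DifferentiableWithinAt ℝ f Ω (r, t)) (hΩ : ∀ s ∈ Icc 0 t, (r, s) ∈ Ω) :
    Tendsto (fun ε => (f (r, t) - f (r, t - ε)) / ε) (𝓝[>] 0) (𝓝 (dt Ω f (r, t))) := by
  have h := hasDerivWithinAt_comp_path (X := fun _ => r) (Y := fun t => t) (s := Icc 0 t) hf
    (hasDerivWithinAt_const t _ r) (hasDerivWithinAt_id t _) hΩ
  rw [hasDerivWithinAt_iff_tendsto_slope, zero_mul, add_zero] at h
  have hg : Tendsto (fun ε : ℝ => t - ε) (𝓝[>] 0) (𝓝[Icc 0 t \ {t}] t) := by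
    refine tendsto_nhdsWithin_iff.2 ⟨?_, ?_⟩
    · have : Tendsto (fun ε : ℝ => t - ε) (𝓝 0) (𝓝 (t - 0)) := by
        exact (continuous_const.sub continuous_id).tendsto 0
      rw [sub_zero] at this
      exact this.mono_left nhdsWithin_le_nhds
    · filter_upwards [Ioo_mem_nhdsGT ht] with ε hε
      exact ⟨⟨by linarith [hε.2], by linarith [hε.1]⟩, by simp [hε.1.ne']⟩
  refine (h.comp hg).congr' ?_
  filter_upwards [self_mem_nhdsWithin] with ε hε
  have hε' : ε ≠ 0 := (ne_of_gt hε)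
  simp only [Function.comp, slope_def_field, sub_sub_cancel_left]
  rw [div_eq_div_iff (neg_ne_zero.2 hε') hε']; ring

theorem abs_sub_le_of_dt_le {Ω : Set (ℝ × ℝ)} {f : ℝ × ℝ → ℝ} {r s t C : ℝ}
    (hf : ContDiffOn ℝ 1 f Ω) (hst : s ≤ t) (hΩ : ∀ x ∈ Icc s t, (r, x) ∈ Ω)
    (hC : ∀ x ∈ Icc s t, |dt Ω f (r, x)| ≤ C) : |f (r, t) - f (r, s)| ≤ C * (t - s) := by
  have := (convex_Icc s t).norm_image_sub_le_of_norm_hasDerivWithin_le (f := fun x => f (r, x))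
    (f' := fun x => dt Ω f (r, x)) (C := C) (x := s) (y := t)
    (fun x hx => by
      simpa using hasDerivWithinAt_comp_path (X := fun _ => r) (Y := fun t => t) (s := Icc s t)
        ((hf.differentiableOn one_ne_zero) _ (hΩ x hx)) (hasDerivWithinAt_const x _ r)
        (hasDerivWithinAt_id x _) hΩ)
    hC (left_mem_Icc.2 hst) (right_mem_Icc.2 hst)
  rwa [Real.norm_eq_abs, Real.norm_eq_abs, abs_of_nonneg (sub_nonneg.2 hst)] at this

namespace IsDiagonalSolution

variable {a b κ : ℝ} {Ω : Set (ℝ × ℝ)} {p q : ℝ × ℝ → ℝ}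

theorem swap (h : IsDiagonalSolution a b κ Ω p q) : IsDiagonalSolution a b κ Ω q p :=
  ⟨h.radius_pos, h.uniqueDiffOn, h.backward, h.contDiffOn_right, h.contDiffOn_left, h.eq_right,
    h.eq_left⟩

/-- The rate of change of `p_t` along a characteristic of the first family. -/
def dtRate (a b κ : ℝ) (Ω : Set (ℝ × ℝ)) (p q : ℝ × ℝ → ℝ) (x : ℝ × ℝ) : ℝ :=
  -(2 * κ / x.1 * (p x * dt Ω p x - q x * dt Ω q x))
    - (a * dt Ω p x + b * dt Ω q x) * dr Ω p x

theorem continuousOn_dtRate (h : IsDiagonalSolution a b κ Ω p q) :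
    ContinuousOn (dtRate a b κ Ω p q) Ω := by
  have c1 := h.contDiffOn_left.continuousOn
  have c2 := h.contDiffOn_right.continuousOn
  have c3 := continuousOn_dt h.uniqueDiffOn h.contDiffOn_left
  have c4 := continuousOn_dt h.uniqueDiffOn h.contDiffOn_right
  have c5 := continuousOn_dr h.uniqueDiffOn h.contDiffOn_left
  have c6 : ContinuousOn (fun x : ℝ × ℝ => 2 * κ / x.1) Ω :=
    continuousOn_const.div continuousOn_fst fun x hx => (h.radius_pos x hx).ne'
  exact ((c6.mul ((c1.mul c3).sub (c2.mul c4))).neg).sub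
    (((continuousOn_const.mul c3).add (continuousOn_const.mul c4)).mul c5)

/-- The rate of change of the backward difference `p(r, t) - p(r, t - ε)` along a characteristic
of the first family, divided by `ε`. -/
def quotientRate (a b κ : ℝ) (Ω : Set (ℝ × ℝ)) (p q : ℝ × ℝ → ℝ) (ε : ℝ) (x : ℝ × ℝ) : ℝ :=
  -(κ / x.1 * ((p x + p (x.1, x.2 - ε)) * ((p x - p (x.1, x.2 - ε)) / ε)
      - (q x + q (x.1, x.2 - ε)) * ((q x - q (x.1, x.2 - ε)) / ε)))
    - (a * ((p x - p (x.1, x.2 - ε)) / ε) + b * ((q x - q (x.1, x.2 - ε)) / ε))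
      * dr Ω p (x.1, x.2 - ε)

/-- Along a characteristic of the first family `p_t` satisfies the equation that one obtains by
formally differentiating the system in `t`, although `p` is only `C¹`. Since the system does not
involve `t` explicitly, the difference of the solution and its translate in time satisfies a
transport equation; divided by the length of the translation and integrated along the
characteristic, it passes to the limit by dominated convergence. The translation is backward in
time, for the domain need not contain vertical segments upward. -/
theorem hasDerivAt_dt (h : IsDiagonalSolution a b κ Ω p q) {X : ℝ → ℝ} {t₁ t₂ : ℝ}
    (hX : IsCharacteristic (fun x => a * p x + b * q x) Ω X t₁ t₂) (ht₁ : 0 ≤ t₁) {t : ℝ}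
    (ht : t ∈ Ioo t₁ t₂) :
    HasDerivAt (fun s => dt Ω p (X s, s)) (dtRate a b κ Ω p q (X t, t)) t := by
  obtain ⟨s₁, hs₁⟩ := exists_between ht.1
  have hs₁0 : 0 < s₁ := ht₁.trans_lt hs₁.1
  have hX' := hX.mono hs₁.1.le le_rfl
  -- a compact set that contains all vertical segments below the characteristic
  set K : Set (ℝ × ℝ) := (fun x : ℝ × ℝ => (X x.1, x.2 * x.1)) '' (Icc s₁ t₂ ×ˢ Icc 0 1) with hK
  have hKc : IsCompact K := by
    refine (isCompact_Icc.prod isCompact_Icc).image_of_continuousOn ?_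
    exact (hX'.continuousOn.comp continuousOn_fst fun x hx => hx.1).prodMk
      (continuous_snd.mul continuous_fst).continuousOn
  have hKmem : ∀ s ∈ Icc s₁ t₂, ∀ x ∈ Icc 0 s, (X s, x) ∈ K := by
    intro s hs x hx
    have hs0 : 0 < s := hs₁0.trans_le hs.1
    exact ⟨(s, x / s), ⟨hs, div_nonneg hx.1 hs0.le, (div_le_one hs0).2 hx.2⟩, by
      simp [div_mul_cancel₀ _ hs0.ne']⟩
  have hKΩ : K ⊆ Ω := by
    rintro _ ⟨⟨s, θ⟩, ⟨hs, hθ⟩, rfl⟩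
    have hs0 : 0 < s := hs₁0.trans_le hs.1
    exact h.backward _ _ _ (hX'.mem s hs) (mul_nonneg hθ.1 hs0.le)
      (by nlinarith [hθ.2] : θ * s ≤ s)
  have c1 := h.contDiffOn_left.continuousOn
  have c2 := h.contDiffOn_right.continuousOn
  have c3 := continuousOn_dt h.uniqueDiffOn h.contDiffOn_left
  have c4 := continuousOn_dt h.uniqueDiffOn h.contDiffOn_right
  have c5 := continuousOn_dr h.uniqueDiffOn h.contDiffOn_left
  have c6 : ContinuousOn (fun x : ℝ × ℝ => κ / x.1) Ω :=
    continuousOn_const.div continuousOn_fst fun x hx => (h.radius_pos x hx).ne'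
  have hbd : ∀ f : ℝ × ℝ → ℝ, ContinuousOn f Ω → ∃ C, ∀ x ∈ K, |f x| ≤ C := fun f hf =>
    hKc.exists_bound_of_continuousOn (hf.mono hKΩ)
  obtain ⟨C1, hC1⟩ := hbd p c1
  obtain ⟨C2, hC2⟩ := hbd q c2
  obtain ⟨C3, hC3⟩ := hbd _ c3
  obtain ⟨C4, hC4⟩ := hbd _ c4
  obtain ⟨C5, hC5⟩ := hbd _ c5
  obtain ⟨C6, hC6⟩ := hbd _ c6
  have hdown : ∀ ε ∈ Ioo 0 s₁, ∀ s ∈ Icc s₁ t₂, (X s, s - ε) ∈ K := fun ε hε s hs =>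
    hKmem s hs _ ⟨by linarith [hε.2, hs.1], by linarith [hε.1]⟩
  have hon : ∀ s ∈ Icc s₁ t₂, (X s, s) ∈ K := fun s hs =>
    hKmem s hs _ ⟨hs₁0.le.trans hs.1, le_rfl⟩
  -- continuity along the translated characteristic
  have hcd : ∀ f : ℝ × ℝ → ℝ, ContinuousOn f Ω → ∀ ε ∈ Ioo 0 s₁,
      ContinuousOn (fun s => f (X s, s - ε)) (Icc s₁ t₂) := fun f hf ε hε =>
    hf.comp (hX'.continuousOn.prodMk (continuousOn_id.sub continuousOn_const))
      fun s hs => hKΩ (hdown ε hε s hs)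
  have hcq : ∀ ε ∈ Ioo 0 s₁,
      ContinuousOn (fun s => quotientRate a b κ Ω p q ε (X s, s)) (Icc s₁ t₂) := by
    intro ε hε
    have d1 := hX'.continuousOn_comp c1
    have d2 := hX'.continuousOn_comp c2
    have d6 := hX'.continuousOn_comp c6
    have e1 := hcd _ c1 ε hε
    have e2 := hcd _ c2 ε hε
    have e5 := hcd _ c5 ε hε
    have f1 := (d1.sub e1).div_const ε
    have f2 := (d2.sub e2).div_const ε
    exact ((d6.mul (((d1.add e1).mul f1).sub ((d2.add e2).mul f2))).neg).sub
      (((continuousOn_const.mul f1).add (continuousOn_const.mul f2)).mul e5)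
  -- the transport equation of the difference quotient
  have hquot : ∀ ε ∈ Ioo 0 s₁, ∀ s ∈ Icc s₁ t₂,
      ∫ x in s₁..s, quotientRate a b κ Ω p q ε (X x, x)
        = (p (X s, s) - p (X s, s - ε)) / ε - (p (X s₁, s₁) - p (X s₁, s₁ - ε)) / ε := by
    intro ε hε s hs
    refine intervalIntegral.integral_eq_sub_of_hasDerivAt_of_le
      (f := fun s => (p (X s, s) - p (X s, s - ε)) / ε) hs.1 ?_ ?_ ?_
    · exact (((hX'.continuousOn_comp c1).sub (hcd _ c1 ε hε)).div_const ε).mono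
        (Icc_subset_Icc_right hs.2)
    · intro x hx
      have hx' : x ∈ Icc s₁ t₂ := ⟨hx.1.le, hx.2.le.trans hs.2⟩
      have g1 := hX'.hasDerivWithinAt_comp h.contDiffOn_left hx'
      have g2 := hasDerivWithinAt_comp_path (Y := fun x => x - ε)
        (h.contDiffOn_left.differentiableOn one_ne_zero _ (hKΩ (hdown ε hε x hx')))
        (hX'.deriv x hx') ((hasDerivWithinAt_id x _).sub_const ε)
        fun s hs => hKΩ (hdown ε hε s hs)
      have g3 := ((g1.sub g2).div_const ε).hasDerivAt
        (Icc_mem_nhds hx.1 (hx.2.trans_le hs.2))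
      refine g3.congr_deriv ?_
      have k1 := h.eq_left _ (hKΩ (hon x hx'))
      have k2 := h.eq_left _ (hKΩ (hdown ε hε x hx'))
      have hr := (h.radius_pos _ (hKΩ (hon x hx'))).ne'
      have hε0 := hε.1.ne'
      simp only at k1 k2 hr ⊢
      rw [k1, eq_sub_of_add_eq k2, quotientRate]
      field_simp
      ring
    · exact ((hcq ε hε).mono (by rw [uIcc_of_le hs.1]; exact Icc_subset_Icc_right hs.2)
        ).intervalIntegrable
  have hlim : ∀ f : ℝ × ℝ → ℝ, ContDiffOn ℝ 1 f Ω → ∀ s ∈ Icc s₁ t₂,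
      Tendsto (fun ε => (f (X s, s) - f (X s, s - ε)) / ε) (𝓝[>] 0)
        (𝓝 (dt Ω f (X s, s))) := fun f hf s hs =>
    tendsto_backward_quotient (hs₁0.trans_le hs.1)
      (hf.differentiableOn one_ne_zero _ (hKΩ (hon s hs)))
      fun x hx => hKΩ (hKmem s hs x hx)
  have hlimc : ∀ f : ℝ × ℝ → ℝ, ContinuousOn f Ω → ∀ s ∈ Icc s₁ t₂,
      Tendsto (fun ε => f (X s, s - ε)) (𝓝[>] 0) (𝓝 (f (X s, s))) := by
    intro f hf s hs
    refine Tendsto.comp (hf _ (hKΩ (hon s hs))) (tendsto_nhdsWithin_iff.2 ⟨?_, ?_⟩)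
    · have : Tendsto (fun ε : ℝ => (X s, s - ε)) (𝓝 0) (𝓝 (X s, s - 0)) :=
        (continuous_const.prodMk (continuous_const.sub continuous_id)).tendsto 0
      rw [sub_zero] at this
      exact this.mono_left nhdsWithin_le_nhds
    · filter_upwards [Ioo_mem_nhdsGT hs₁0] with ε hε
      exact hKΩ (hdown ε hε s hs)
  have habs : ∀ f : ℝ × ℝ → ℝ, ContDiffOn ℝ 1 f Ω → ∀ C, (∀ x ∈ K, |dt Ω f x| ≤ C) →
      ∀ ε ∈ Ioo 0 s₁, ∀ s ∈ Icc s₁ t₂, |(f (X s, s) - f (X s, s - ε)) / ε| ≤ C := by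
    intro f hf C hC ε hε s hs
    rw [abs_div, abs_of_pos hε.1, div_le_iff₀ hε.1]
    have hsub : ∀ x ∈ Icc (s - ε) s, (X s, x) ∈ K := fun x hx =>
      hKmem s hs x ⟨by linarith [hx.1, hs.1, hε.2], hx.2⟩
    have := abs_sub_le_of_dt_le (r := X s) (s := s - ε) (t := s) hf (by linarith [hε.1])
      (fun x hx => hKΩ (hsub x hx)) fun x hx => hC _ (hsub x hx)
    simpa using this
  have hint : ∀ s ∈ Icc s₁ t₂, ∫ x in s₁..s, dtRate a b κ Ω p q (X x, x)
      = dt Ω p (X s, s) - dt Ω p (X s₁, s₁) := by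
    intro s hs
    have hsub : ∀ x ∈ uIoc s₁ s, x ∈ Icc s₁ t₂ := by
      intro x hx
      rw [uIoc_of_le hs.1] at hx
      exact ⟨hx.1.le, hx.2.trans hs.2⟩
    have hL := intervalIntegral.tendsto_integral_filter_of_dominated_convergence
      (μ := MeasureTheory.volume) (a := s₁) (b := s) (l := 𝓝[>] (0 : ℝ))
      (F := fun ε x => quotientRate a b κ Ω p q ε (X x, x))
      (f := fun x => dtRate a b κ Ω p q (X x, x))
      (fun _ => C6 * ((C1 + C1) * C3 + (C2 + C2) * C4) + (|a| * C3 + |b| * C4) * C5)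
      ?_ ?_ (by simp) ?_
    · refine tendsto_nhds_unique hL ?_
      refine Tendsto.congr' ?_ ((hlim p h.contDiffOn_left s hs).sub
        (hlim p h.contDiffOn_left s₁ ⟨le_rfl, hs.1.trans hs.2⟩))
      filter_upwards [Ioo_mem_nhdsGT hs₁0] with ε hε
      exact (hquot ε hε s hs).symm
    · filter_upwards [Ioo_mem_nhdsGT hs₁0] with ε hε
      refine ContinuousOn.aestronglyMeasurable ((hcq ε hε).mono hsub) measurableSet_uIoc
    · filter_upwards [Ioo_mem_nhdsGT hs₁0] with ε hε
      refine Eventually.of_forall fun x hx => ?_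
      have hx := hsub x hx
      have m1 := habs p h.contDiffOn_left C3 hC3 ε hε x hx
      have m2 := habs q h.contDiffOn_right C4 hC4 ε hε x hx
      have n1 := hC1 _ (hon x hx)
      have n1' := hC1 _ (hdown ε hε x hx)
      have n2 := hC2 _ (hon x hx)
      have n2' := hC2 _ (hdown ε hε x hx)
      have n5 := hC5 _ (hdown ε hε x hx)
      have n6 := hC6 _ (hon x hx)
      rw [Real.norm_eq_abs, quotientRate]
      simp only at n6 ⊢
      refine (abs_sub _ _).trans ?_
      rw [abs_neg, abs_mul, abs_mul]
      have i1 := (abs_nonneg _).trans n1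
      have i2 := (abs_nonneg _).trans n2
      have i3 := (abs_nonneg _).trans m1
      have i4 := (abs_nonneg _).trans m2
      have i5 := (abs_nonneg _).trans n5
      have i6 := (abs_nonneg _).trans n6
      gcongr
      · refine (abs_sub _ _).trans ?_
        rw [abs_mul, abs_mul]
        gcongr
        · exact (abs_add_le _ _).trans (add_le_add n1 n1')
        · exact (abs_add_le _ _).trans (add_le_add n2 n2')
      · refine (abs_add_le _ _).trans ?_
        rw [abs_mul, abs_mul]
        gcongr
    · refine Eventually.of_forall fun x hx => ?_
      have hx := hsub x hx
      have l1 := hlim p h.contDiffOn_left x hx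
      have l2 := hlim q h.contDiffOn_right x hx
      have l3 := hlimc p c1 x hx
      have l4 := hlimc q c2 x hx
      have l5 := hlimc _ c5 x hx
      have := (((((l3.const_add (p (X x, x))).mul l1).sub
        ((l4.const_add (q (X x, x))).mul l2)).const_mul (κ / X x)).neg).sub
          (((l1.const_mul a).add (l2.const_mul b)).mul l5)
      have e : dtRate a b κ Ω p q (X x, x)
          = -(κ / X x * ((p (X x, x) + p (X x, x)) * dt Ω p (X x, x)
              - (q (X x, x) + q (X x, x)) * dt Ω q (X x, x)))
            - (a * dt Ω p (X x, x) + b * dt Ω q (X x, x)) * dr Ω p (X x, x) := by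
        simp only [dtRate]; ring
      rw [e]
      exact this
  have hcR : ContinuousOn (fun x => dtRate a b κ Ω p q (X x, x)) (Icc s₁ t₂) :=
    hX'.continuousOn_comp h.continuousOn_dtRate
  have htI : t ∈ Icc s₁ t₂ := ⟨hs₁.2.le, ht.2.le⟩
  have hnhds : Icc s₁ t₂ ∈ 𝓝 t := Icc_mem_nhds hs₁.2 ht.2
  have hder : HasDerivAt (fun s => ∫ x in s₁..s, dtRate a b κ Ω p q (X x, x))
      (dtRate a b κ Ω p q (X t, t)) t := by
    refine intervalIntegral.integral_hasDerivAt_right ?_ ?_ (hcR.continuousAt hnhds)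
    · exact (hcR.mono (by
        rw [uIcc_of_le htI.1]; exact Icc_subset_Icc_right htI.2)).intervalIntegrable
    · exact (hcR.mono Ioo_subset_Icc_self).stronglyMeasurableAtFilter isOpen_Ioo t ⟨hs₁.2, ht.2⟩
  refine (hder.add_const (dt Ω p (X s₁, s₁))).congr_of_eventuallyEq ?_
  filter_upwards [hnhds] with s hs
  rw [hint s hs, sub_add_cancel]

end IsDiagonalSolution

/-! ### The Riccati equation of the weighted gradient variables -/

/-- The gradient variable `-p_t / (a p + b q)` of the first family. -/
def grad (a b : ℝ) (Ω : Set (ℝ × ℝ)) (p q : ℝ × ℝ → ℝ) (x : ℝ × ℝ) : ℝ :=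
  -dt Ω p x / (a * p x + b * q x)

/-- The weight `|p - q| ^ (-b / (a - b))`. Its rate of change along a characteristic of either
family cancels the product of the two gradient variables in the Riccati equation. It is written
through `Real.log`, which is even, so that it is symmetric in `p` and `q`. -/
def weight (a b : ℝ) (p q : ℝ × ℝ → ℝ) (x : ℝ × ℝ) : ℝ :=
  Real.exp (-(b / (a - b)) * Real.log (p x - q x))

theorem weight_comm (a b : ℝ) (p q : ℝ × ℝ → ℝ) (x : ℝ × ℝ) :
    weight a b q p x = weight a b p q x := by
  rw [weight, weight, ← Real.log_neg_eq_log, neg_sub]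

theorem weight_pos (a b : ℝ) (p q : ℝ × ℝ → ℝ) (x : ℝ × ℝ) : 0 < weight a b p q x :=
  Real.exp_pos _

/-- The weighted gradient variable of the first family. -/
def wgrad (a b : ℝ) (Ω : Set (ℝ × ℝ)) (p q : ℝ × ℝ → ℝ) (x : ℝ × ℝ) : ℝ :=
  grad a b Ω p q x * weight a b p q x

/-- The coefficient of the weighted gradient variable itself in its Riccati equation. -/
def selfCoeff (a b κ : ℝ) (p q : ℝ × ℝ → ℝ) (x : ℝ × ℝ) : ℝ :=
  κ / x.1 * (2 * a * (p x ^ 2 - q x ^ 2) / (a * p x + b * q x)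
    - b * (p x ^ 2 - q x ^ 2) / (a * q x + b * p x) - 2 * p x
    + b / (a - b) * (p x + q x) * (1 + (a * p x + b * q x) / (a * q x + b * p x)))

/-- The coefficient of the weighted gradient variable of the other family. -/
def crossCoeff (a b κ : ℝ) (p q : ℝ × ℝ → ℝ) (x : ℝ × ℝ) : ℝ :=
  κ / x.1 * ((a * q x + b * p x) / (a * p x + b * q x) ^ 2)
    * (b * (p x ^ 2 - q x ^ 2) + 2 * q x * (a * p x + b * q x))

namespace IsDiagonalSolution

variable {a b κ : ℝ} {Ω : Set (ℝ × ℝ)} {p q : ℝ × ℝ → ℝ} {X : ℝ → ℝ} {t₁ t₂ t : ℝ}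

theorem hasDerivAt_log_sub (h : IsDiagonalSolution a b κ Ω p q)
    (hX : IsCharacteristic (fun x => a * p x + b * q x) Ω X t₁ t₂)
    (ht : t ∈ Ioo t₁ t₂) (hpq : p (X t, t) ≠ q (X t, t))
    (hq : a * q (X t, t) + b * p (X t, t) ≠ 0) :
    HasDerivAt (fun s => Real.log (p (X s, s) - q (X s, s)))
      (-((a - b) * grad a b Ω q p (X t, t)) - κ / X t * ((p (X t, t) + q (X t, t)) *
        (1 + (a * p (X t, t) + b * q (X t, t)) / (a * q (X t, t) + b * p (X t, t))))) t := by
  have ht' := Ioo_subset_Icc_self ht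
  have g1 := hX.hasDerivAt_comp h.contDiffOn_left ht
  have g2 := hX.hasDerivAt_comp h.contDiffOn_right ht
  have hne : p (X t, t) - q (X t, t) ≠ 0 := sub_ne_zero.2 hpq
  refine ((g1.sub g2).log hne).congr_deriv ?_
  have k1 := h.eq_left _ (hX.mem t ht')
  have k2 := h.eq_right _ (hX.mem t ht')
  have hr := (h.radius_pos _ (hX.mem t ht')).ne'
  simp only at k1 k2 hr ⊢
  rw [k1]
  have k3 : dr Ω q (X t, t) = (-(κ * (q (X t, t) ^ 2 - p (X t, t) ^ 2) / X t) - dt Ω q (X t, t))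
      / (a * q (X t, t) + b * p (X t, t)) := by
    rw [eq_div_iff hq]; linarith
  rw [k3, grad]
  simp only [Pi.sub_apply]
  generalize p (X t, t) = P at *
  generalize q (X t, t) = Q at *
  generalize dt Ω q (X t, t) = q' at *
  obtain ⟨U, hU⟩ : ∃ U, U = a * Q + b * P := ⟨_, rfl⟩
  rw [← hU] at hq ⊢
  field_simp
  rw [hU]
  ring

theorem hasDerivAt_grad (h : IsDiagonalSolution a b κ Ω p q)
    (hX : IsCharacteristic (fun x => a * p x + b * q x) Ω X t₁ t₂) (ht₁ : 0 ≤ t₁)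
    (ht : t ∈ Ioo t₁ t₂) (hp : a * p (X t, t) + b * q (X t, t) ≠ 0)
    (hq : a * q (X t, t) + b * p (X t, t) ≠ 0) :
    HasDerivAt (fun s => grad a b Ω p q (X s, s))
      (-(a * grad a b Ω p q (X t, t) ^ 2)
        - b * grad a b Ω p q (X t, t) * grad a b Ω q p (X t, t)
        + κ / X t * (2 * a * (p (X t, t) ^ 2 - q (X t, t) ^ 2) / (a * p (X t, t) + b * q (X t, t))
          - b * (p (X t, t) ^ 2 - q (X t, t) ^ 2) / (a * q (X t, t) + b * p (X t, t))
          - 2 * p (X t, t)) * grad a b Ω p q (X t, t)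
        + crossCoeff a b κ p q (X t, t) * grad a b Ω q p (X t, t)) t := by
  have ht' := Ioo_subset_Icc_self ht
  have g0 := h.hasDerivAt_dt hX ht₁ ht
  have g1 := hX.hasDerivAt_comp h.contDiffOn_left ht
  have g2 := hX.hasDerivAt_comp h.contDiffOn_right ht
  refine (g0.neg.div ((g1.const_mul a).add (g2.const_mul b)) hp).congr_deriv ?_
  have k1 := h.eq_left _ (hX.mem t ht')
  have k2 := h.eq_right _ (hX.mem t ht')
  have hr := (h.radius_pos _ (hX.mem t ht')).ne'
  simp only at k1 k2 hr ⊢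
  have k3 : dr Ω q (X t, t) = (-(κ * (q (X t, t) ^ 2 - p (X t, t) ^ 2) / X t) - dt Ω q (X t, t))
      / (a * q (X t, t) + b * p (X t, t)) := by
    rw [eq_div_iff hq]; linarith
  have k4 : dr Ω p (X t, t) = (-(κ * (p (X t, t) ^ 2 - q (X t, t) ^ 2) / X t) - dt Ω p (X t, t))
      / (a * p (X t, t) + b * q (X t, t)) := by
    rw [eq_div_iff hp]; linarith
  rw [dtRate, crossCoeff, grad, grad, k3, k4]
  simp only [Pi.add_apply, Pi.neg_apply]
  generalize p (X t, t) = P at *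
  generalize q (X t, t) = Q at *
  generalize dt Ω q (X t, t) = q' at *
  generalize dt Ω p (X t, t) = p' at *
  obtain ⟨U, hU⟩ : ∃ U, U = a * Q + b * P := ⟨_, rfl⟩
  obtain ⟨V, hV⟩ : ∃ V, V = a * P + b * Q := ⟨_, rfl⟩
  rw [← hU] at hq
  rw [← hV] at hp
  rw [← hU, ← hV]
  field_simp
  rw [hU, hV]
  ring

/-- The Riccati equation of the weighted gradient variable. -/
theorem hasDerivAt_wgrad (h : IsDiagonalSolution a b κ Ω p q)
    (hX : IsCharacteristic (fun x => a * p x + b * q x) Ω X t₁ t₂) (ht₁ : 0 ≤ t₁)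
    (ht : t ∈ Ioo t₁ t₂) (hp : a * p (X t, t) + b * q (X t, t) ≠ 0)
    (hq : a * q (X t, t) + b * p (X t, t) ≠ 0) (hpq : p (X t, t) ≠ q (X t, t)) (hab : a ≠ b) :
    HasDerivAt (fun s => wgrad a b Ω p q (X s, s))
      (-(a / weight a b p q (X t, t) * wgrad a b Ω p q (X t, t) ^ 2)
        + selfCoeff a b κ p q (X t, t) * wgrad a b Ω p q (X t, t)
        + crossCoeff a b κ p q (X t, t) * wgrad a b Ω q p (X t, t)) t := by
  have g1 := h.hasDerivAt_grad hX ht₁ ht hp hq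
  have g2 := ((h.hasDerivAt_log_sub hX ht hpq hq).const_mul (-(b / (a - b)))).exp
  refine (g1.mul g2).congr_deriv ?_
  have hG := (weight_pos a b p q (X t, t)).ne'
  have hab' : a - b ≠ 0 := sub_ne_zero.2 hab
  rw [wgrad, wgrad, weight_comm a b p q, selfCoeff]
  change _ * weight a b p q (X t, t) + _ * (weight a b p q (X t, t) * _) = _
  generalize weight a b p q (X t, t) = G at *
  generalize crossCoeff a b κ p q (X t, t) = M at *
  generalize grad a b Ω p q (X t, t) = A at *
  generalize grad a b Ω q p (X t, t) = A' at *
  generalize p (X t, t) = P at *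
  generalize q (X t, t) = Q at *
  simp only
  generalize (a * P + b * Q) / (a * Q + b * P) = V
  generalize 2 * a * (P ^ 2 - Q ^ 2) / (a * P + b * Q) = V1
  generalize b * (P ^ 2 - Q ^ 2) / (a * Q + b * P) = V2
  generalize κ / X t = k
  field_simp
  ring

end IsDiagonalSolution

/-! ### Existence of characteristics -/

theorem abs_sub_le_of_dr_le {Ω : Set (ℝ × ℝ)} {f : ℝ × ℝ → ℝ} {t C r₁ r₂ : ℝ}
    (hf : ContDiffOn ℝ 1 f Ω) (hΩ : ∀ r ∈ Icc r₁ r₂, (r, t) ∈ Ω)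
    (hC : ∀ r ∈ Icc r₁ r₂, |dr Ω f (r, t)| ≤ C) {x y : ℝ} (hx : x ∈ Icc r₁ r₂)
    (hy : y ∈ Icc r₁ r₂) : |f (x, t) - f (y, t)| ≤ C * |x - y| := by
  refine (convex_Icc r₁ r₂).norm_image_sub_le_of_norm_hasDerivWithin_le (f := fun r => f (r, t))
    (f' := fun r => dr Ω f (r, t)) (fun r hr => ?_) hC hy hx
  exact (hf.differentiableOn one_ne_zero _ (hΩ r hr)).hasFDerivWithinAt.comp_hasDerivWithinAt
    (f := fun r => (r, t)) r ((hasDerivWithinAt_id r _).prodMk (hasDerivWithinAt_const r _ t)) hΩ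

/-- Integral curves of a `C¹` field, extended past the edges `r = B t` and `r = R` of a trapezoid
by its values on them, exist on the whole time interval. -/
theorem exists_clipped_curve {B : ℝ → ℝ} {T₀ τ R : ℝ} {c : ℝ × ℝ → ℝ} (hτ : τ < T₀)
    (hB : ContinuousOn B (Icc 0 τ)) (hBR : ∀ t ∈ Icc 0 τ, B t ≤ R)
    (hΩ : UniqueDiffOn ℝ (region B T₀)) (hc : ContDiffOn ℝ 1 c (region B T₀)) {t₀ : ℝ}
    (ht₀ : t₀ ∈ Icc 0 τ) (x₀ : ℝ) :
    ∃ X : ℝ → ℝ, X t₀ = x₀ ∧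
      ∀ t ∈ Icc 0 τ, HasDerivWithinAt X (c (max (B t) (min (X t) R), t)) (Icc 0 τ) t := by
  have hD := isCompact_trapezoid R hB
  have hDΩ : trapezoid B τ R ⊆ region B T₀ := trapezoid_subset_region hτ
  obtain ⟨K, hK⟩ := hD.exists_bound_of_continuousOn ((continuousOn_dr hΩ hc).mono hDΩ)
  obtain ⟨L, hL⟩ := hD.exists_bound_of_continuousOn (hc.continuousOn.mono hDΩ)
  have hclip : ∀ t ∈ Icc 0 τ, ∀ x, max (B t) (min x R) ∈ Icc (B t) R := fun t ht x =>
    ⟨le_max_left _ _, max_le (hBR t ht) (min_le_right _ _)⟩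
  have hmem : ∀ t ∈ Icc 0 τ, ∀ r ∈ Icc (B t) R, (r, t) ∈ trapezoid B τ R := fun t ht r hr =>
    ⟨ht.1, ht.2, hr.1, hr.2⟩
  have hL0 : 0 ≤ L := (norm_nonneg _).trans (hL _ (hmem t₀ ht₀ _ (hclip t₀ ht₀ x₀)))
  have hK0 : 0 ≤ K := (norm_nonneg _).trans (hK _ (hmem t₀ ht₀ _ (hclip t₀ ht₀ x₀)))
  have hτ0 : 0 ≤ τ := ht₀.1.trans ht₀.2
  have hPL : IsPicardLindelof (fun t x => c (max (B t) (min x R), t)) (⟨t₀, ht₀⟩ : Icc 0 τ) x₀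
      (⟨L, hL0⟩ * ⟨τ, hτ0⟩) 0 ⟨L, hL0⟩ ⟨K, hK0⟩ := by
    refine ⟨?_, ?_, ?_, ?_⟩
    · intro t ht
      refine LipschitzOnWith.of_dist_le_mul fun x _ y _ => ?_
      rw [Real.dist_eq, Real.dist_eq]
      refine (abs_sub_le_of_dr_le hc (fun r hr => hDΩ (hmem t ht r hr))
        (fun r hr => hK _ (hmem t ht r hr)) (hclip t ht x) (hclip t ht y)).trans ?_
      refine mul_le_mul_of_nonneg_left ?_ hK0
      calc |max (B t) (min x R) - max (B t) (min y R)|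
          ≤ max |B t - B t| |min x R - min y R| := abs_max_sub_max_le_max _ _ _ _
        _ = |min x R - min y R| := by simp
        _ ≤ max |x - y| |R - R| := abs_min_sub_min_le_max _ _ _ _
        _ = |x - y| := by simp
    · intro x _
      exact hc.continuousOn.comp ((hB.sup continuousOn_const).prodMk continuousOn_id)
        fun t ht => hDΩ (hmem t ht _ (hclip t ht x))
    · intro t ht x _
      exact hL _ (hmem t ht _ (hclip t ht x))
    · simp only [NNReal.coe_zero, sub_zero]
      exact mul_le_mul_of_nonneg_left (max_le (by linarith [ht₀.1]) (by linarith [ht₀.2])) hL0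
  obtain ⟨X, hX0, hX⟩ := hPL.exists_eq_forall_mem_Icc_hasDerivWithinAt
    (x := x₀) (Metric.mem_closedBall_self le_rfl)
  exact ⟨X, hX0, hX⟩

section

variable {B B' : ℝ → ℝ} {T₀ : ℝ} {c : ℝ × ℝ → ℝ}

/-- Forward characteristics exist up to time `t₂` if the lateral boundary cannot overtake them:
either it is slower on the boundary itself, or its distance is too large. -/
theorem exists_forward_characteristic {L r₁ t₁ t₂ : ℝ}
    (hB : ∀ t ∈ Ico 0 T₀, HasDerivWithinAt B (B' t) (Ico 0 T₀) t)
    (hc : ContDiffOn ℝ 1 c (region B T₀)) (hc0 : ∀ x ∈ region B T₀, 0 ≤ c x)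
    (hcL : ∀ x ∈ region B T₀, c x ≤ L) (h₁ : (r₁, t₁) ∈ region B T₀) (h₁₂ : t₁ < t₂)
    (h₂ : t₂ < T₀)
    (hside : (∀ t ∈ Ico 0 T₀, B' t ≤ c (B t, t)) ∨
      (∀ t ∈ Ico 0 T₀, B' t ≤ L) ∧ L * (t₂ - t₁) ≤ r₁ - B t₁) :
    ∃ X : ℝ → ℝ, X t₁ = r₁ ∧ IsCharacteristic c (region B T₀) X t₁ t₂ := by
  obtain ⟨h₁0, h₁T, h₁B⟩ := h₁
  simp only at h₁0 h₁T h₁B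
  have hsub : Icc 0 t₂ ⊆ Ico 0 T₀ := fun t ht => ⟨ht.1, ht.2.trans_lt h₂⟩
  have hBc : ContinuousOn B (Icc 0 t₂) := fun t ht =>
    ((hB t (hsub ht)).continuousWithinAt).mono hsub
  obtain ⟨M, hM⟩ := (isCompact_Icc.image_of_continuousOn hBc).bddAbove
  set R := max M (r₁ + L * (t₂ - t₁)) with hR
  have hBR : ∀ t ∈ Icc 0 t₂, B t ≤ R := fun t ht => (hM ⟨t, ht, rfl⟩).trans (le_max_left _ _)
  obtain ⟨X, hX1, hX⟩ := exists_clipped_curve h₂ hBc hBR (uniqueDiffOn_region hB) hc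
    (t₀ := t₁) ⟨h₁0, h₁₂.le⟩ r₁
  have hs : Icc t₁ t₂ ⊆ Icc 0 t₂ := Icc_subset_Icc_left h₁0
  have hX' := fun t ht => (hX t (hs ht)).mono hs
  have hB' := fun t ht => (hB t (hsub (hs ht))).mono (hs.trans hsub)
  have hclip : ∀ t ∈ Icc t₁ t₂, (max (B t) (min (X t) R), t) ∈ region B T₀ := fun t ht =>
    ⟨(hs ht).1, ht.2.trans_lt h₂, le_max_left _ _⟩
  have hXB : ∀ t ∈ Icc t₁ t₂, B t ≤ X t := by
    rcases hside with hside | ⟨hBL, hfar⟩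
    · intro t ht
      refine sub_nonneg.1 (nonneg_of_deriv_nonneg_of_neg
        (fun t ht => (hX' t ht).sub (hB' t ht)) (fun t ht hneg => ?_) ?_ t ht)
      · simp only [Pi.sub_apply] at hneg
        have e : max (B t) (min (X t) R) = B t :=
          max_eq_left ((min_le_left _ _).trans (by linarith))
        rw [e]
        exact sub_nonneg.2 (hside t (hsub (hs ht)))
      · simp only [Pi.sub_apply]; rw [hX1]; linarith
    · intro t ht
      have hL0 : 0 ≤ L := (hc0 _ (hclip t ht)).trans (hcL _ (hclip t ht))
      have h3 := nonneg_of_deriv_nonneg_of_neg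
        (fun t ht => (((hX' t ht).sub (hB' t ht)).add
          ((hasDerivWithinAt_id t (Icc t₁ t₂)).const_mul L)).sub_const (r₁ - B t₁ + L * t₁))
        (fun t ht _ => by
          have := hc0 _ (hclip t ht)
          have := hBL t (hsub (hs ht))
          linarith) (by simp [hX1]) t ht
      simp only [Pi.add_apply, Pi.sub_apply, id] at h3
      nlinarith [ht.1, ht.2]
  have hXR : ∀ t ∈ Icc t₁ t₂, X t ≤ R := by
    intro t ht
    have h3 := nonneg_of_deriv_nonneg_of_neg
      (fun t ht => (((hasDerivWithinAt_id t (Icc t₁ t₂)).const_mul L).sub (hX' t ht)).sub_const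
        (L * t₁ - r₁))
      (fun t ht _ => by
        have := hcL _ (hclip t ht)
        linarith) (by simp [hX1]) t ht
    simp only [Pi.sub_apply, id] at h3
    have hL0 : 0 ≤ L := (hc0 _ (hclip t ht)).trans (hcL _ (hclip t ht))
    refine le_trans ?_ (le_max_right _ _)
    nlinarith [ht.1, ht.2]
  refine ⟨X, hX1, fun t ht => ⟨(hs ht).1, ht.2.trans_lt h₂, hXB t ht⟩, fun t ht => ?_⟩
  have := hX' t ht
  rwa [min_eq_left (hXR t ht), max_eq_right (hXB t ht)] at this

/-- A short backward characteristic through a point of the domain, if the point lies off the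
lateral boundary or the lateral boundary is not slower than the characteristics. -/
theorem exists_backward_characteristic {r₀ t₀ : ℝ}
    (hB : ∀ t ∈ Ico 0 T₀, HasDerivWithinAt B (B' t) (Ico 0 T₀) t)
    (hBm : MonotoneOn B (Ico 0 T₀))
    (hc : ContDiffOn ℝ 1 c (region B T₀)) (hc0 : ∀ x ∈ region B T₀, 0 ≤ c x)
    (h₀ : (r₀, t₀) ∈ region B T₀) (ht₀ : 0 < t₀)
    (hside : (∀ t ∈ Ico 0 T₀, c (B t, t) ≤ B' t) ∨ B t₀ < r₀) :
    ∃ X : ℝ → ℝ, ∃ t₁, 0 ≤ t₁ ∧ t₁ < t₀ ∧ X t₀ = r₀ ∧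
      IsCharacteristic c (region B T₀) X t₁ t₀ ∧ ∀ t ∈ Icc t₁ t₀, X t ≤ r₀ := by
  obtain ⟨-, h₀T, h₀B⟩ := h₀
  simp only at h₀T h₀B
  have hsub : Icc 0 t₀ ⊆ Ico 0 T₀ := fun t ht => ⟨ht.1, ht.2.trans_lt h₀T⟩
  have hBc : ContinuousOn B (Icc 0 t₀) := fun t ht =>
    ((hB t (hsub ht)).continuousWithinAt).mono hsub
  have hBR : ∀ t ∈ Icc 0 t₀, B t ≤ r₀ := fun t ht =>
    (hBm (hsub ht) ⟨ht₀.le, h₀T⟩ ht.2).trans h₀B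
  obtain ⟨X, hX0, hX⟩ := exists_clipped_curve h₀T hBc hBR (uniqueDiffOn_region hB) hc
    (t₀ := t₀) ⟨ht₀.le, le_rfl⟩ r₀
  have hclip : ∀ t ∈ Icc 0 t₀, (max (B t) (min (X t) r₀), t) ∈ region B T₀ := fun t ht =>
    ⟨ht.1, ht.2.trans_lt h₀T, le_max_left _ _⟩
  have hXc : ContinuousOn X (Icc 0 t₀) := fun t ht => (hX t ht).continuousWithinAt
  -- the time-reversed curve
  have hrev : ∀ t ∈ Icc 0 t₀, t₀ - t ∈ Icc 0 t₀ := fun t ht =>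
    ⟨by linarith [ht.2], by linarith [ht.1]⟩
  have hrd : ∀ (f : ℝ → ℝ) (f' : ℝ → ℝ),
      (∀ t ∈ Icc 0 t₀, HasDerivWithinAt f (f' t) (Icc 0 t₀) t) → ∀ t ∈ Icc 0 t₀,
      HasDerivWithinAt (fun s => f (t₀ - s)) (-f' (t₀ - t)) (Icc 0 t₀) t := by
    intro f f' hf t ht
    have := (hf _ (hrev t ht)).scomp t ((hasDerivWithinAt_id t (Icc 0 t₀)).const_sub t₀) hrev
    simpa [Function.comp_def] using this
  have hXle : ∀ t ∈ Icc 0 t₀, X t ≤ r₀ := by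
    intro t ht
    have := nonneg_of_deriv_nonneg_of_neg
      (fun t ht => (hrd X _ hX t ht).const_sub r₀)
      (fun t ht _ => by rw [neg_neg]; exact hc0 _ (hclip _ (hrev t ht)))
      (by simp [hX0]) (t₀ - t) (hrev t ht)
    simpa using this
  have key : ∃ t₁, 0 ≤ t₁ ∧ t₁ < t₀ ∧ ∀ t ∈ Icc t₁ t₀, B t ≤ X t := by
    rcases hside with hside | hlt
    · refine ⟨0, le_rfl, ht₀, fun t ht => ?_⟩
      have := nonneg_of_deriv_nonneg_of_neg
        (fun t ht => (hrd X _ hX t ht).sub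
          (hrd B B' (fun t ht => (hB t (hsub ht)).mono hsub) t ht))
        (fun t ht hneg => by
          simp only [Pi.sub_apply] at hneg
          have e : max (B (t₀ - t)) (min (X (t₀ - t)) r₀) = B (t₀ - t) :=
            max_eq_left ((min_le_left _ _).trans (by linarith))
          rw [e]
          linarith [hside _ (hsub (hrev t ht))])
        (by simp [hX0, h₀B]) (t₀ - t) (hrev t ht)
      simpa using this
    · have hev : ∀ᶠ t in 𝓝[Icc 0 t₀] t₀, B t < X t :=
        ((hBc t₀ ⟨ht₀.le, le_rfl⟩).tendsto).eventually_lt (hXc t₀ ⟨ht₀.le, le_rfl⟩)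
          (by rw [hX0]; exact hlt)
      rw [eventually_nhdsWithin_iff, Metric.eventually_nhds_iff] at hev
      obtain ⟨ε, hε, hev⟩ := hev
      refine ⟨max 0 (t₀ - ε / 2), le_max_left _ _, max_lt ht₀ (by linarith), fun t ht => ?_⟩
      have e1 := (le_max_left _ _).trans ht.1
      have e2 := (le_max_right _ _).trans ht.1
      refine (hev (y := t) ?_ ⟨e1, ht.2⟩).le
      rw [Real.dist_eq, abs_lt]
      constructor <;> linarith [ht.2]
  obtain ⟨t₁, ht₁0, ht₁, hXB⟩ := key
  have hs : Icc t₁ t₀ ⊆ Icc 0 t₀ := Icc_subset_Icc_left ht₁0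
  refine ⟨X, t₁, ht₁0, ht₁, hX0, ⟨fun t ht => ⟨(hs ht).1, ht.2.trans_lt h₀T, hXB t ht⟩,
    fun t ht => ?_⟩, fun t ht => hXle t (hs ht)⟩
  have := (hX t (hs ht)).mono hs
  rwa [min_eq_left (hXle t (hs ht)), max_eq_right (hXB t ht)] at this

end

/-! ### A priori bounds -/

/-- The two components are nonnegative, distinct and at most `W`, and the radius is at least
`b₀`. -/
structure StateRange (b₀ W : ℝ) (Ω : Set (ℝ × ℝ)) (p q : ℝ × ℝ → ℝ) : Prop where
  left_nonneg : ∀ x ∈ Ω, 0 ≤ p x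
  right_nonneg : ∀ x ∈ Ω, 0 ≤ q x
  ne : ∀ x ∈ Ω, p x ≠ q x
  left_le : ∀ x ∈ Ω, p x ≤ W
  right_le : ∀ x ∈ Ω, q x ≤ W
  le_radius : ∀ x ∈ Ω, b₀ ≤ x.1

namespace StateRange

variable {b₀ W : ℝ} {Ω : Set (ℝ × ℝ)} {p q : ℝ × ℝ → ℝ} {x : ℝ × ℝ}

theorem swap (h : StateRange b₀ W Ω p q) : StateRange b₀ W Ω q p :=
  ⟨h.right_nonneg, h.left_nonneg, fun x hx => (h.ne x hx).symm, h.right_le, h.left_le,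
    h.le_radius⟩

theorem add_pos (h : StateRange b₀ W Ω p q) (hx : x ∈ Ω) : 0 < p x + q x := by
  have h1 := h.left_nonneg x hx
  have h2 := h.right_nonneg x hx
  rcases h1.eq_or_lt with e | e
  · rcases h2.eq_or_lt with e' | e'
    · exact absurd (e.symm.trans e') (h.ne x hx)
    · linarith
  · linarith

theorem speed_pos (h : StateRange b₀ W Ω p q) (hx : x ∈ Ω) {a b : ℝ} (ha : 0 < a) (hb : 0 < b) :
    0 < a * p x + b * q x := by
  have h1 := h.left_nonneg x hx
  have h2 := h.right_nonneg x hx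
  have h3 := h.add_pos hx
  rcases h1.eq_or_lt with e | e
  · rw [← e] at h3 ⊢
    have := mul_pos hb (by linarith : 0 < q x)
    linarith
  · have := mul_pos ha e
    have := mul_nonneg hb.le h2
    linarith

theorem continuousOn_weight (h : StateRange b₀ W Ω p q) (hp : ContinuousOn p Ω)
    (hq : ContinuousOn q Ω) (a b : ℝ) : ContinuousOn (weight a b p q) Ω :=
  Real.continuous_exp.comp_continuousOn
    (continuousOn_const.mul ((hp.sub hq).log fun x hx => sub_ne_zero.2 (h.ne x hx)))

theorem log_sub_le (h : StateRange b₀ W Ω p q) (hx : x ∈ Ω) :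
    Real.log (p x - q x) ≤ Real.log W := by
  have h1 := h.left_nonneg x hx
  have h2 := h.right_nonneg x hx
  have h3 := h.left_le x hx
  have h4 := h.right_le x hx
  rw [← Real.log_abs]
  exact Real.log_le_log (abs_pos.2 (sub_ne_zero.2 (h.ne x hx)))
    (abs_sub_le_iff.2 ⟨by linarith, by linarith⟩)

theorem le_weight (h : StateRange b₀ W Ω p q) (hx : x ∈ Ω) {a b : ℝ} (hb : 0 < b) (hab : b < a) :
    Real.exp (-(b / (a - b)) * Real.log W) ≤ weight a b p q x := by
  rw [weight, Real.exp_le_exp]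
  have : 0 < b / (a - b) := div_pos hb (by linarith)
  nlinarith [h.log_sub_le hx]

end StateRange

/-- Up to the factor `κ / r`, the coefficients of the Riccati equation and the part of the rate of
change of `log (p - q)` that does not involve the gradient variable are homogeneous of degree one in
`(p, q)`, with denominators comparable to powers of `p + q`. Hence they are bounded uniformly in the
solution. -/
theorem exists_coeff_bound {a b κ b₀ W : ℝ} (hb : 0 < b) (hab : b < a) (hab1 : a + b = 1)
    (hκ : 0 < κ) (hb₀ : 0 < b₀) :
    ∃ Λ : ℝ, 0 ≤ Λ ∧ ∀ (Ω : Set (ℝ × ℝ)) (p q : ℝ × ℝ → ℝ), StateRange b₀ W Ω p q → ∀ x ∈ Ω,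
      |selfCoeff a b κ p q x| ≤ Λ ∧ 0 ≤ crossCoeff a b κ p q x ∧ crossCoeff a b κ p q x ≤ Λ ∧
      κ / x.1 * ((p x + q x) * (1 + (a * p x + b * q x) / (a * q x + b * p x))) ≤ Λ := by
  have hk : 0 < b / (a - b) := div_pos hb (by linarith)
  set k := b / (a - b) with hkdef
  refine ⟨κ / b₀ * ((2 / b + 1 + 2 + (k + 1) * (1 + 1 / b) + 3 / b ^ 2) * (2 * |W|)),
    by positivity, ?_⟩
  intro Ω p q h x hx
  have h1 := h.left_nonneg x hx
  have h2 := h.right_nonneg x hx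
  have hS := h.add_pos hx
  have hr := h.le_radius x hx
  have hSW : p x + q x ≤ 2 * |W| := by
    linarith [h.left_le x hx, h.right_le x hx, le_abs_self W]
  have hr0 : 0 < x.1 := hb₀.trans_le hr
  have hκr : κ / x.1 ≤ κ / b₀ := div_le_div_of_nonneg_left hκ.le hb₀ hr
  have hκr0 : 0 < κ / x.1 := div_pos hκ hr0
  rw [selfCoeff, crossCoeff, ← hkdef]
  generalize p x = P at *
  generalize q x = Q at *
  generalize κ / x.1 = c at *
  -- the two speeds are comparable to `P + Q`
  have hV1 : b * (P + Q) ≤ a * P + b * Q := by nlinarith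
  have hV2 : a * P + b * Q ≤ P + Q := by nlinarith
  have hU1 : b * (P + Q) ≤ a * Q + b * P := by nlinarith
  have hU2 : a * Q + b * P ≤ P + Q := by nlinarith
  set V := a * P + b * Q
  set U := a * Q + b * P
  set S := P + Q
  have hbS : 0 < b * S := mul_pos hb hS
  have hV0 : 0 < V := hbS.trans_le hV1
  have hU0 : 0 < U := hbS.trans_le hU1
  have hPQ : |P ^ 2 - Q ^ 2| ≤ S ^ 2 := by
    rw [abs_sub_le_iff]; constructor <;> nlinarith
  have i1 : |2 * a * (P ^ 2 - Q ^ 2) / V| ≤ 2 / b * S := by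
    rw [abs_div, abs_of_pos hV0, div_le_iff₀ hV0, abs_mul, abs_of_pos (by linarith : 0 < 2 * a)]
    calc 2 * a * |P ^ 2 - Q ^ 2| ≤ 2 * 1 * S ^ 2 := by gcongr; linarith
      _ = 2 / b * S * (b * S) := by field_simp
      _ ≤ 2 / b * S * V := by gcongr
  have i2 : |b * (P ^ 2 - Q ^ 2) / U| ≤ S := by
    rw [abs_div, abs_of_pos hU0, div_le_iff₀ hU0, abs_mul, abs_of_pos hb]
    calc b * |P ^ 2 - Q ^ 2| ≤ b * S ^ 2 := by gcongr
      _ = S * (b * S) := by ring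
      _ ≤ S * U := by gcongr
  have i3 : V / U ≤ 1 / b := by
    rw [div_le_div_iff₀ hU0 hb]; nlinarith
  have i3' : 0 ≤ V / U := (div_pos hV0 hU0).le
  have i4 : S * (1 + V / U) ≤ S * (1 + 1 / b) := by gcongr
  have i4' : 0 ≤ S * (1 + V / U) := by positivity
  have hcS : ∀ A y : ℝ, 0 ≤ A → y ≤ A * S → c * y ≤ κ / b₀ * (A * (2 * |W|)) := by
    intro A y hA hy
    calc c * y ≤ c * (A * S) := by gcongr
      _ ≤ κ / b₀ * (A * (2 * |W|)) := by gcongr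
  have hmono : ∀ A A' : ℝ, A ≤ A' → κ / b₀ * (A * (2 * |W|)) ≤ κ / b₀ * (A' * (2 * |W|)) := by
    intro A A' hA
    gcongr
  have hb1 : 0 ≤ 1 / b := by positivity
  have hb2 : 0 ≤ 2 / b := by positivity
  have hb3 : 0 ≤ 3 / b ^ 2 := by positivity
  have hkb : 0 ≤ k * (1 + 1 / b) := by positivity
  have j : 0 ≤ b * (P ^ 2 - Q ^ 2) + 2 * Q * V := by nlinarith [mul_nonneg h1 h2]
  refine ⟨?_, ?_, ?_, ?_⟩
  · rw [abs_mul, abs_of_pos hκr0]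
    refine (hcS (2 / b + 1 + 2 + k * (1 + 1 / b)) _ (by positivity) ?_).trans
      (hmono _ _ (by linarith))
    have e : k * S * (1 + V / U) = k * (S * (1 + V / U)) := by ring
    rw [e]
    have i5 : k * (S * (1 + V / U)) ≤ k * (1 + 1 / b) * S := by
      calc k * (S * (1 + V / U)) ≤ k * (S * (1 + 1 / b)) := by gcongr
        _ = _ := by ring
    have i5' : 0 ≤ k * (S * (1 + V / U)) := by positivity
    have hPS : P ≤ S := by simp only [S]; linarith
    obtain ⟨a1, a2⟩ := abs_le.1 i1
    obtain ⟨b1, b2⟩ := abs_le.1 i2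
    rw [abs_le]
    constructor <;> linarith
  · positivity
  · rw [mul_assoc]
    refine (hcS (3 / b ^ 2) _ (by positivity) ?_).trans (hmono _ _ (by linarith))
    have k1 : U / V ^ 2 ≤ S / (b * S) ^ 2 := by gcongr
    have k2 : b * (P ^ 2 - Q ^ 2) + 2 * Q * V ≤ 3 * S ^ 2 := by
      have : b * (P ^ 2 - Q ^ 2) ≤ 1 * S ^ 2 := by
        calc b * (P ^ 2 - Q ^ 2) ≤ b * S ^ 2 := by
              gcongr; exact (le_abs_self _).trans hPQ
          _ ≤ 1 * S ^ 2 := by gcongr; linarith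
      have : 2 * Q * V ≤ 2 * S * S := by
        have : Q ≤ S := by simp only [S]; linarith
        gcongr
      linarith
    calc U / V ^ 2 * (b * (P ^ 2 - Q ^ 2) + 2 * Q * V) ≤ S / (b * S) ^ 2 * (3 * S ^ 2) := by
          gcongr
      _ = 3 / b ^ 2 * S := by field_simp
  · refine (hcS (1 + 1 / b) _ (by positivity) (by linarith)).trans (hmono _ _ (by linarith))

namespace IsDiagonalSolution

variable {a b κ b₀ W : ℝ} {Ω : Set (ℝ × ℝ)} {p q : ℝ × ℝ → ℝ}

theorem continuousOn_grad (h : IsDiagonalSolution a b κ Ω p q) (hs : StateRange b₀ W Ω p q)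
    (ha : 0 < a) (hb : 0 < b) : ContinuousOn (grad a b Ω p q) Ω :=
  (continuousOn_dt h.uniqueDiffOn h.contDiffOn_left).neg.div
    ((continuousOn_const.mul h.contDiffOn_left.continuousOn).add
      (continuousOn_const.mul h.contDiffOn_right.continuousOn))
    fun _ hx => (hs.speed_pos hx ha hb).ne'

theorem continuousOn_wgrad (h : IsDiagonalSolution a b κ Ω p q) (hs : StateRange b₀ W Ω p q)
    (ha : 0 < a) (hb : 0 < b) : ContinuousOn (wgrad a b Ω p q) Ω :=
  (h.continuousOn_grad hs ha hb).mul (hs.continuousOn_weight h.contDiffOn_left.continuousOn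
    h.contDiffOn_right.continuousOn a b)

theorem continuousOn_selfCoeff (h : IsDiagonalSolution a b κ Ω p q) (hs : StateRange b₀ W Ω p q)
    (ha : 0 < a) (hb : 0 < b) : ContinuousOn (selfCoeff a b κ p q) Ω := by
  have hp := h.contDiffOn_left.continuousOn
  have hq := h.contDiffOn_right.continuousOn
  have c1 : ContinuousOn (fun x : ℝ × ℝ => κ / x.1) Ω :=
    continuousOn_const.div continuousOn_fst fun x hx => (h.radius_pos x hx).ne'
  have hV : ∀ x ∈ Ω, a * p x + b * q x ≠ 0 := fun x hx => (hs.speed_pos hx ha hb).ne'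
  have hU : ∀ x ∈ Ω, a * q x + b * p x ≠ 0 := fun x hx => (hs.swap.speed_pos hx ha hb).ne'
  unfold selfCoeff
  fun_prop (disch := assumption)

theorem continuousOn_crossCoeff (h : IsDiagonalSolution a b κ Ω p q)
    (hs : StateRange b₀ W Ω p q)
    (ha : 0 < a) (hb : 0 < b) : ContinuousOn (crossCoeff a b κ p q) Ω := by
  have hp := h.contDiffOn_left.continuousOn
  have hq := h.contDiffOn_right.continuousOn
  have c1 : ContinuousOn (fun x : ℝ × ℝ => κ / x.1) Ω :=
    continuousOn_const.div continuousOn_fst fun x hx => (h.radius_pos x hx).ne'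
  have hV : ∀ x ∈ Ω, (a * p x + b * q x) ^ 2 ≠ 0 := fun x hx =>
    pow_ne_zero 2 (hs.speed_pos hx ha hb).ne'
  unfold crossCoeff
  fun_prop (disch := assumption)

/-- The right-hand side of the Riccati equation. -/
def riccatiRate (a b κ : ℝ) (Ω : Set (ℝ × ℝ)) (p q : ℝ × ℝ → ℝ) (x : ℝ × ℝ) : ℝ :=
  -(a / weight a b p q x * wgrad a b Ω p q x ^ 2)
    + selfCoeff a b κ p q x * wgrad a b Ω p q x + crossCoeff a b κ p q x * wgrad a b Ω q p x

theorem continuousOn_riccatiRate (h : IsDiagonalSolution a b κ Ω p q)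
    (hs : StateRange b₀ W Ω p q) (ha : 0 < a) (hb : 0 < b) :
    ContinuousOn (riccatiRate a b κ Ω p q) Ω := by
  have c1 := h.continuousOn_wgrad hs ha hb
  have c2 := h.swap.continuousOn_wgrad hs.swap ha hb
  have c3 := h.continuousOn_selfCoeff hs ha hb
  have c4 := h.continuousOn_crossCoeff hs ha hb
  have c5 := hs.continuousOn_weight h.contDiffOn_left.continuousOn
    h.contDiffOn_right.continuousOn a b
  exact ((((continuousOn_const.div c5 fun _ _ => (weight_pos a b p q _).ne').mul
    (c1.pow 2)).neg).add (c3.mul c1)).add (c4.mul c2)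

variable {X : ℝ → ℝ} {t₁ t₂ : ℝ}

/-- Where a weighted gradient variable is positive and dominates the other one, its product with
`e ^ (-(2 Λ + 1) t)` decreases along its characteristic: the quadratic term has the good sign and
the coefficient of the other variable is nonnegative. -/
theorem exists_wgrad_gt {Λ : ℝ} (h : IsDiagonalSolution a b κ Ω p q)
    (hs : StateRange b₀ W Ω p q) (hb : 0 < b) (hab : b < a)
    (hΛ : ∀ x ∈ Ω, |selfCoeff a b κ p q x| ≤ Λ ∧ 0 ≤ crossCoeff a b κ p q x ∧
      crossCoeff a b κ p q x ≤ Λ)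
    (hX : IsCharacteristic (fun x => a * p x + b * q x) Ω X t₁ t₂) (ht₁ : 0 ≤ t₁)
    (ht : t₁ < t₂) (hpos : 0 < wgrad a b Ω p q (X t₂, t₂))
    (hdom : wgrad a b Ω q p (X t₂, t₂) ≤ wgrad a b Ω p q (X t₂, t₂)) :
    ∃ t ∈ Icc t₁ t₂, Real.exp (-(2 * Λ + 1) * t₂) * wgrad a b Ω p q (X t₂, t₂)
      < Real.exp (-(2 * Λ + 1) * t) * wgrad a b Ω p q (X t, t) := by
  have ha := hb.trans hab
  have hE : ∀ t : ℝ, HasDerivAt (fun t => Real.exp (-(2 * Λ + 1) * t))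
      (Real.exp (-(2 * Λ + 1) * t) * -(2 * Λ + 1)) t := fun t => by
    simpa using ((hasDerivAt_id t).const_mul (-(2 * Λ + 1))).exp
  have hEc : ContinuousOn (fun t : ℝ => Real.exp (-(2 * Λ + 1) * t)) (Icc t₁ t₂) :=
    fun t _ => (hE t).continuousAt.continuousWithinAt
  have hwc := hX.continuousOn_comp (h.continuousOn_wgrad hs ha hb)
  refine exists_gt_of_hasDerivAt_neg (f := fun t =>
    Real.exp (-(2 * Λ + 1) * t) * wgrad a b Ω p q (X t, t))
    (f' := fun t => Real.exp (-(2 * Λ + 1) * t) * -(2 * Λ + 1) * wgrad a b Ω p q (X t, t)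
      + Real.exp (-(2 * Λ + 1) * t) * riccatiRate a b κ Ω p q (X t, t)) ht (hEc.mul hwc) ?_ ?_ ?_
  · intro t ht
    have hm := hX.mem t (Ioo_subset_Icc_self ht)
    exact (hE t).mul (h.hasDerivAt_wgrad hX ht₁ ht (hs.speed_pos hm ha hb).ne'
      (hs.swap.speed_pos hm ha hb).ne' (hs.ne _ hm) hab.ne')
  · exact ((hEc.mul continuousOn_const).mul hwc).add
      (hEc.mul (hX.continuousOn_comp (h.continuousOn_riccatiRate hs ha hb)))
  · have hm := hX.mem t₂ (right_mem_Icc.2 ht.le)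
    obtain ⟨h1, h2, h3⟩ := hΛ _ hm
    have hG := weight_pos a b p q (X t₂, t₂)
    have hE0 := Real.exp_pos (-(2 * Λ + 1) * t₂)
    rw [mul_assoc, ← mul_add, riccatiRate]
    refine mul_neg_of_pos_of_neg hE0 ?_
    have q1 : 0 ≤ a / weight a b p q (X t₂, t₂) * wgrad a b Ω p q (X t₂, t₂) ^ 2 := by
      positivity
    have q2 := mul_le_mul_of_nonneg_right ((abs_le.1 h1).2) hpos.le
    have q3 := mul_le_mul_of_nonneg_left hdom h2
    have q4 := mul_le_mul_of_nonneg_right h3 hpos.le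
    linarith

/-- Blow-up of the gradient variable along a characteristic of length `η`, given a bound on the
other gradient variable and a lower bound on the coefficient of the quadratic term. -/
theorem false_of_grad_le {Λ M g₀ g₁ η : ℝ} (h : IsDiagonalSolution a b κ Ω p q)
    (hs : StateRange b₀ W Ω p q) (hb : 0 < b) (hab : b < a)
    (hΛ : ∀ x ∈ Ω, |selfCoeff a b κ p q x| ≤ Λ ∧ 0 ≤ crossCoeff a b κ p q x ∧
      crossCoeff a b κ p q x ≤ Λ)
    (hX : IsCharacteristic (fun x => a * p x + b * q x) Ω X t₁ (t₁ + η)) (ht₁ : 0 ≤ t₁)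
    (hη : 0 < η) (hM : 0 < M) (hg₀ : 0 < g₀) (hg₁ : 0 < g₁)
    (hw : ∀ t ∈ Icc t₁ (t₁ + η), wgrad a b Ω q p (X t, t) ≤ M)
    (hg₀w : ∀ x ∈ Ω, g₀ ≤ weight a b p q x)
    (hg₁w : ∀ t ∈ Icc t₁ (t₁ + η), weight a b p q (X t, t) ≤ g₁)
    (hgrad : grad a b Ω p q (X t₁, t₁)
      ≤ -((1 + 2 * Λ * (1 + M) * g₁ / a + 2 * g₁ / (a * η) + 1) / g₀)) : False := by
  have ha := hb.trans hab
  have hmem := hX.mem t₁ (left_mem_Icc.2 (by linarith))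
  have hΛ0 : 0 ≤ Λ := (abs_nonneg _).trans (hΛ _ hmem).1
  have hY : 1 + 2 * Λ * (1 + M) * g₁ / a + 2 * g₁ / (a * η) + 1
      ≤ -wgrad a b Ω p q (X t₁, t₁) := by
    have hG := hg₀w _ hmem
    have : 0 ≤ 1 + 2 * Λ * (1 + M) * g₁ / a + 2 * g₁ / (a * η) + 1 := by positivity
    set N := 1 + 2 * Λ * (1 + M) * g₁ / a + 2 * g₁ / (a * η) + 1
    have h1 : N / g₀ * g₀ ≤ -grad a b Ω p q (X t₁, t₁) * weight a b p q (X t₁, t₁) :=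
      mul_le_mul_of_nonneg' (by linarith) hG hg₀.le
        (le_trans (by positivity) (by linarith : N / g₀ ≤ -grad a b Ω p q (X t₁, t₁)))
    rw [div_mul_cancel₀ _ hg₀.ne'] at h1
    rw [wgrad]; linarith
  have p1 : 0 ≤ 2 * Λ * (1 + M) * g₁ / a := by positivity
  have p2 : 0 < 2 * g₁ / (a * η) := by positivity
  refine false_of_riccati (f := fun t => -wgrad a b Ω p q (X t, t))
    (f' := fun t => -riccatiRate a b κ Ω p q (X t, t)) (t₁ := t₁) (t₂ := t₁ + η)
    (c := a / (2 * g₁)) (N := 1 + 2 * Λ * (1 + M) * g₁ / a) (by linarith)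
    (hX.continuousOn_comp (h.continuousOn_wgrad hs ha hb)).neg ?_ ?_ (by positivity)
    (by positivity) (by linarith) ?_
  · intro t ht
    have hm := hX.mem t (Ioo_subset_Icc_self ht)
    exact (h.hasDerivAt_wgrad hX ht₁ ht (hs.speed_pos hm ha hb).ne'
      (hs.swap.speed_pos hm ha hb).ne' (hs.ne _ hm) hab.ne').neg
  · intro t ht hN
    have ht' := Ioo_subset_Icc_self ht
    obtain ⟨h1, h2, h3⟩ := hΛ _ (hX.mem t ht')
    have hG := weight_pos a b p q (X t, t)
    have hG1 := hg₁w t ht'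
    have hB := hw t ht'
    rw [riccatiRate]
    generalize wgrad a b Ω p q (X t, t) = A at *
    generalize wgrad a b Ω q p (X t, t) = A' at *
    generalize weight a b p q (X t, t) = G at *
    obtain ⟨Y, rfl⟩ : ∃ Y, A = -Y := ⟨-A, by ring⟩
    rw [neg_neg] at hN ⊢
    have hY1 : 1 ≤ Y := by linarith
    -- half of the quadratic term absorbs the two other ones
    have q0 : a / g₁ * Y ^ 2 ≤ a / G * Y ^ 2 := by gcongr
    have q1 : selfCoeff a b κ p q (X t, t) * Y ≤ Λ * Y :=
      mul_le_mul_of_nonneg_right ((abs_le.1 h1).2) (by linarith)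
    have q1' : -(Λ * Y) ≤ selfCoeff a b κ p q (X t, t) * Y := by
      have := mul_le_mul_of_nonneg_right ((abs_le.1 h1).1) (by linarith : 0 ≤ Y)
      linarith
    have q2 : crossCoeff a b κ p q (X t, t) * A' ≤ Λ * M * Y := by
      calc crossCoeff a b κ p q (X t, t) * A' ≤ crossCoeff a b κ p q (X t, t) * M := by gcongr
        _ ≤ Λ * M := by gcongr
        _ ≤ Λ * M * Y := le_mul_of_one_le_right (by positivity) hY1
    have q3 : Λ * (1 + M) * Y ≤ a / (2 * g₁) * Y ^ 2 := by
      have : 2 * Λ * (1 + M) * g₁ / a ≤ Y := by linarith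
      calc Λ * (1 + M) * Y = a / (2 * g₁) * ((2 * Λ * (1 + M) * g₁ / a) * Y) := by field_simp
        _ ≤ a / (2 * g₁) * (Y * Y) := by gcongr
        _ = _ := by ring
    have q4 : a / g₁ = a / (2 * g₁) + a / (2 * g₁) := by field_simp; ring
    rw [q4] at q0
    have e : (-Y) ^ 2 = Y ^ 2 := by ring
    rw [e]
    nlinarith
  · rw [add_sub_cancel_left]
    have : 2 * g₁ / (a * η) < -wgrad a b Ω p q (X t₁, t₁) := by linarith
    calc (1 : ℝ) = a / (2 * g₁) * η * (2 * g₁ / (a * η)) := by field_simp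
      _ < _ := by gcongr

end IsDiagonalSolution

/-- Maximum principle: a continuous function on the domain whose value exceeds `μ` at a point
is larger still at some earlier point that does not lie to the right. Applied with backward
characteristics, which run to the left. -/
theorem le_of_exists_gt {B : ℝ → ℝ} {T₀ T μ : ℝ} {f : ℝ × ℝ → ℝ}
    (hB : ContinuousOn B (Ico 0 T₀)) (hf : ContinuousOn f (region B T₀))
    (h : ∀ x ∈ region B T₀, x.2 ≤ T → μ < f x →
      ∃ y ∈ region B T₀, y.2 ≤ x.2 ∧ y.1 ≤ x.1 ∧ f x < f y) :
    ∀ x ∈ region B T₀, x.2 ≤ T → f x ≤ μ := by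
  intro x hx hxT
  by_contra! hlt
  have hD := isCompact_trapezoid (τ := x.2) x.1
    (hB.mono fun t ht => ⟨ht.1, ht.2.trans_lt hx.2.1⟩)
  have hsub : trapezoid B x.2 x.1 ⊆ region B T₀ := trapezoid_subset_region hx.2.1
  obtain ⟨y, hy, hmax⟩ := hD.exists_isMaxOn ⟨x, hx.1, le_rfl, hx.2.2, le_rfl⟩ (hf.mono hsub)
  have hxy : f x ≤ f y := hmax ⟨hx.1, le_rfl, hx.2.2, le_rfl⟩
  obtain ⟨z, hz, hz2, hz1, hzf⟩ := h y (hsub hy) (hy.2.1.trans hxT) (hlt.trans_le hxy)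
  have : f z ≤ f y := hmax ⟨hz.1, hz2.trans hy.2.1, hz.2.2, hz1.trans hy.2.2.2⟩
  linarith

/-! ### Solutions with bounded data -/

/-- A solution of the diagonal system with ordered components `0 ≤ z < w`, to the right of a
characteristic `r = B t` with `B 0 = b₀`, whose data satisfy `w ≤ W`, `H ≤ w - z`, and have
weighted gradient variables bounded above by `M`. The lateral boundary is a characteristic of the
faster family, or one of the slower family along which the data are bounded as well. -/
structure IsAdmissible (a b κ b₀ W M H T₀ : ℝ) (B B' : ℝ → ℝ) (w z : ℝ × ℝ → ℝ) : Prop where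
  sol : IsDiagonalSolution a b κ (region B T₀) w z
  deriv : ∀ t ∈ Ico 0 T₀, HasDerivWithinAt B (B' t) (Ico 0 T₀) t
  start : B 0 = b₀
  nonneg : ∀ x ∈ region B T₀, 0 ≤ z x
  lt : ∀ x ∈ region B T₀, z x < w x
  initial : ∀ x ∈ region B T₀, x.2 = 0 → wgrad a b (region B T₀) w z x ≤ M ∧
    wgrad a b (region B T₀) z w x ≤ M ∧ H ≤ w x - z x ∧ w x ≤ W
  side : (∀ t ∈ Ico 0 T₀, B' t = a * w (B t, t) + b * z (B t, t)) ∨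
    (∀ t ∈ Ico 0 T₀, B' t = a * z (B t, t) + b * w (B t, t)) ∧
    ∀ t ∈ Ico 0 T₀, wgrad a b (region B T₀) w z (B t, t) ≤ M ∧
      H ≤ w (B t, t) - z (B t, t) ∧ w (B t, t) ≤ W

namespace IsAdmissible

variable {a b κ b₀ W M H T₀ : ℝ} {B B' : ℝ → ℝ} {w z : ℝ × ℝ → ℝ}

theorem continuousOn_boundary (h : IsAdmissible a b κ b₀ W M H T₀ B B' w z) :
    ContinuousOn B (Ico 0 T₀) := fun t ht => (h.deriv t ht).continuousWithinAt

theorem monotoneOn (h : IsAdmissible a b κ b₀ W M H T₀ B B' w z) :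
    MonotoneOn B (Ico 0 T₀) := fun s hs t ht hst =>
  (h.sol.backward (B t) s t ⟨ht.1, ht.2, le_rfl⟩ hs.1 hst).2.2

theorem speed_nonneg (h : IsAdmissible a b κ b₀ W M H T₀ B B' w z) (ha : 0 ≤ a) (hb : 0 ≤ b)
    {x : ℝ × ℝ} (hx : x ∈ region B T₀) :
    0 ≤ a * w x + b * z x ∧ 0 ≤ a * z x + b * w x := by
  have h1 := h.nonneg x hx
  have h2 := h1.trans (h.lt x hx).le
  constructor <;> positivity

theorem contDiffOn_speed (h : IsAdmissible a b κ b₀ W M H T₀ B B' w z) :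
    ContDiffOn ℝ 1 (fun x => a * w x + b * z x) (region B T₀) ∧
    ContDiffOn ℝ 1 (fun x => a * z x + b * w x) (region B T₀) := by
  have h1 := h.sol.contDiffOn_left
  have h2 := h.sol.contDiffOn_right
  constructor <;> fun_prop

theorem boundary_mem {t : ℝ} (ht : t ∈ Ico 0 T₀) : (B t, t) ∈ region B T₀ :=
  ⟨ht.1, ht.2, le_rfl⟩

theorem slow_le_fast (h : IsAdmissible a b κ b₀ W M H T₀ B B' w z) (hab : b < a)
    {x : ℝ × ℝ} (hx : x ∈ region B T₀) : a * z x + b * w x ≤ a * w x + b * z x := by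
  nlinarith [h.lt x hx]

/-- Fast backward characteristics exist off the data. -/
theorem exists_backward_fast (h : IsAdmissible a b κ b₀ W M H T₀ B B' w z) (ha : 0 ≤ a)
    (hb : 0 ≤ b) {x : ℝ × ℝ} (hx : x ∈ region B T₀) (hx0 : x.2 ≠ 0)
    (hside : (∀ t ∈ Ico 0 T₀, B' t = a * w (B t, t) + b * z (B t, t)) ∨ x.1 ≠ B x.2) :
    ∃ X : ℝ → ℝ, ∃ t₁, 0 ≤ t₁ ∧ t₁ < x.2 ∧ X x.2 = x.1 ∧
      IsCharacteristic (fun x => a * w x + b * z x) (region B T₀) X t₁ x.2 ∧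
      ∀ t ∈ Icc t₁ x.2, X t ≤ x.1 :=
  exists_backward_characteristic h.deriv h.monotoneOn h.contDiffOn_speed.1
    (fun _ hy => (h.speed_nonneg ha hb hy).1) hx (lt_of_le_of_ne hx.1 hx0.symm)
    (hside.imp (fun hs t ht => (hs t ht).ge) fun hne => lt_of_le_of_ne hx.2.2 hne.symm)

/-- Slow backward characteristics exist off the initial line. -/
theorem exists_backward_slow (h : IsAdmissible a b κ b₀ W M H T₀ B B' w z) (hb : 0 ≤ b)
    (hab : b < a) {x : ℝ × ℝ} (hx : x ∈ region B T₀) (hx0 : x.2 ≠ 0) :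
    ∃ X : ℝ → ℝ, ∃ t₁, 0 ≤ t₁ ∧ t₁ < x.2 ∧ X x.2 = x.1 ∧
      IsCharacteristic (fun x => a * z x + b * w x) (region B T₀) X t₁ x.2 ∧
      ∀ t ∈ Icc t₁ x.2, X t ≤ x.1 := by
  refine exists_backward_characteristic h.deriv h.monotoneOn h.contDiffOn_speed.2
    (fun _ hy => (h.speed_nonneg (hb.trans hab.le) hb hy).2) hx (lt_of_le_of_ne hx.1 hx0.symm)
    (Or.inl fun t ht => ?_)
  rcases h.side with hs | hs
  · rw [hs t ht]; exact h.slow_le_fast hab (boundary_mem ht)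
  · exact (hs.1 t ht).ge

/-- A function that exceeds its bound `μ` at a point does so off the data. -/
theorem ne_data (h : IsAdmissible a b κ b₀ W M H T₀ B B' w z) {f : ℝ × ℝ → ℝ} {μ : ℝ}
    (h₁ : ∀ x ∈ region B T₀, x.2 = 0 → f x ≤ μ)
    (h₂ : (∀ t ∈ Ico 0 T₀, wgrad a b (region B T₀) w z (B t, t) ≤ M ∧
      H ≤ w (B t, t) - z (B t, t) ∧ w (B t, t) ≤ W) → ∀ t ∈ Ico 0 T₀, f (B t, t) ≤ μ)
    {x : ℝ × ℝ} (hx : x ∈ region B T₀) (hfx : μ < f x) :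
    x.2 ≠ 0 ∧
      ((∀ t ∈ Ico 0 T₀, B' t = a * w (B t, t) + b * z (B t, t)) ∨ x.1 ≠ B x.2) := by
  refine ⟨fun e => absurd (h₁ x hx e) (not_le.2 hfx), ?_⟩
  rcases h.side with hs | hs
  · exact Or.inl hs
  · refine Or.inr fun e => absurd (h₂ hs.2 x.2 ⟨hx.1, hx.2.1⟩) (not_le.2 ?_)
    rwa [← e]

theorem left_le (h : IsAdmissible a b κ b₀ W M H T₀ B B' w z) (hb : 0 < b) (hab : b < a)
    (hκ : 0 < κ) : ∀ x ∈ region B T₀, w x ≤ W := by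
  intro x hx
  refine le_of_exists_gt (T := x.2) h.continuousOn_boundary h.sol.contDiffOn_left.continuousOn
    (fun x hx _ hlt => ?_) x hx le_rfl
  obtain ⟨h0, hside⟩ := h.ne_data (f := w) (fun x hx h0 => (h.initial x hx h0).2.2.2)
    (fun hs t ht => (hs t ht).2.2) hx hlt
  obtain ⟨X, t₁, ht₁, ht, hXx, hX, hXle⟩ :=
    h.exists_backward_fast (hb.trans hab).le hb.le hx h0 hside
  have hrate : ContinuousOn (fun x : ℝ × ℝ => -(κ * (w x ^ 2 - z x ^ 2) / x.1))
      (region B T₀) := by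
    have h1 := h.sol.contDiffOn_left.continuousOn
    have h2 := h.sol.contDiffOn_right.continuousOn
    exact ((continuousOn_const.mul ((h1.pow 2).sub (h2.pow 2))).div continuousOn_fst
      fun x hx => (h.sol.radius_pos x hx).ne').neg
  obtain ⟨t, ht', hgt⟩ := exists_gt_of_hasDerivAt_neg (f := fun t => w (X t, t)) ht
    (hX.continuousOn_comp h.sol.contDiffOn_left.continuousOn)
    (fun t ht => (hX.hasDerivAt_comp h.sol.contDiffOn_left ht).congr_deriv
      (h.sol.eq_left _ (hX.mem t (Ioo_subset_Icc_self ht))))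
    (hX.continuousOn_comp hrate) (by
      have hm := hX.mem x.2 (right_mem_Icc.2 ht.le)
      have hr := h.sol.radius_pos _ hm
      have h1 := h.nonneg _ hm
      have h2 := h.lt _ hm
      have : 0 < w (X x.2, x.2) ^ 2 - z (X x.2, x.2) ^ 2 := by nlinarith
      rw [neg_lt_zero]
      exact div_pos (mul_pos hκ this) hr)
  rw [hXx] at hgt
  exact ⟨(X t, t), hX.mem t ht', ht'.2, hXle t ht', hgt⟩

theorem stateRange (h : IsAdmissible a b κ b₀ W M H T₀ B B' w z) (hb : 0 < b) (hab : b < a)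
    (hκ : 0 < κ) : StateRange b₀ W (region B T₀) w z where
  left_nonneg x hx := (h.nonneg x hx).trans (h.lt x hx).le
  right_nonneg := h.nonneg
  ne x hx := (h.lt x hx).ne'
  left_le := h.left_le hb hab hκ
  right_le x hx := (h.lt x hx).le.trans (h.left_le hb hab hκ x hx)
  le_radius x hx := by
    rw [← h.start]
    exact (h.monotoneOn ⟨le_rfl, hx.1.trans_lt hx.2.1⟩ ⟨hx.1, hx.2.1⟩ hx.1).trans hx.2.2

/-- The weighted gradient variables stay bounded above. -/
theorem wgrad_le {Λ : ℝ} (h : IsAdmissible a b κ b₀ W M H T₀ B B' w z) (hb : 0 < b)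
    (hab : b < a) (hκ : 0 < κ) (hM : 0 < M)
    (hΛ : ∀ p q : ℝ × ℝ → ℝ, StateRange b₀ W (region B T₀) p q → ∀ x ∈ region B T₀,
      |selfCoeff a b κ p q x| ≤ Λ ∧ 0 ≤ crossCoeff a b κ p q x ∧ crossCoeff a b κ p q x ≤ Λ) :
    ∀ x ∈ region B T₀, wgrad a b (region B T₀) w z x ≤ M * Real.exp ((2 * Λ + 1) * x.2) ∧
      wgrad a b (region B T₀) z w x ≤ M * Real.exp ((2 * Λ + 1) * x.2) := by
  intro x hx
  have ha := hb.trans hab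
  have hs := h.stateRange hb hab hκ
  have c1 := h.sol.continuousOn_wgrad hs ha hb
  have c2 := h.sol.swap.continuousOn_wgrad hs.swap ha hb
  have hΛ0 : 0 ≤ Λ := (abs_nonneg _).trans (hΛ w z hs x hx).1
  set E : ℝ → ℝ := fun t => Real.exp (-(2 * Λ + 1) * t) with hE
  have hE0 : ∀ t, 0 < E t := fun t => Real.exp_pos _
  have hE1 : ∀ t, 0 ≤ t → E t ≤ 1 := fun t ht => by
    rw [hE, Real.exp_le_one_iff]; nlinarith
  have hEM : ∀ t y, 0 ≤ t → y ≤ M → E t * y ≤ M := fun t y ht hy => by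
    calc E t * y ≤ E t * M := mul_le_mul_of_nonneg_left hy (hE0 t).le
      _ ≤ 1 * M := mul_le_mul_of_nonneg_right (hE1 t ht) hM.le
      _ = M := one_mul M
  set f : ℝ × ℝ → ℝ := fun x =>
    E x.2 * max (wgrad a b (region B T₀) w z x) (wgrad a b (region B T₀) z w x) with hf
  have key : f x ≤ M := by
    refine le_of_exists_gt (T := x.2) (f := f) h.continuousOn_boundary ?_ ?_ x hx le_rfl
    · exact (Real.continuous_exp.comp_continuousOn
        (continuousOn_const.mul continuousOn_snd)).mul (c1.sup c2)
    · intro y hy _ hlt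
      have hmax : 0 < max (wgrad a b (region B T₀) w z y) (wgrad a b (region B T₀) z w y) :=
        pos_of_mul_pos_right (hM.trans hlt) (hE0 _).le
      rcases le_total (wgrad a b (region B T₀) z w y) (wgrad a b (region B T₀) w z y) with hle | hle
      · have e := max_eq_left hle
        rw [e] at hmax
        have hfy : f y = E y.2 * wgrad a b (region B T₀) w z y := by rw [hf]; simp only [e]
        rw [hfy] at hlt ⊢
        obtain ⟨h0, hside⟩ := h.ne_data
          (f := fun y => E y.2 * wgrad a b (region B T₀) w z y)
          (fun x hx h0 => hEM _ _ hx.1 (h.initial x hx h0).1)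
          (fun hs t ht => hEM _ _ ht.1 (hs t ht).1) hy hlt
        obtain ⟨X, t₁, ht₁, ht, hXx, hX, hXle⟩ := h.exists_backward_fast ha.le hb.le hy h0 hside
        have hXy : (X y.2, y.2) = y := by rw [hXx]
        obtain ⟨t, ht', hgt⟩ := h.sol.exists_wgrad_gt hs hb hab (hΛ w z hs) hX ht₁ ht
          (by rwa [hXy]) (by rwa [hXy])
        rw [hXy] at hgt
        exact ⟨(X t, t), hX.mem t ht', ht'.2, hXle t ht', hgt.trans_le
          (mul_le_mul_of_nonneg_left (le_max_left _ _) (hE0 t).le)⟩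
      · have e := max_eq_right hle
        rw [e] at hmax
        have hfy : f y = E y.2 * wgrad a b (region B T₀) z w y := by rw [hf]; simp only [e]
        rw [hfy] at hlt ⊢
        have h0 : y.2 ≠ 0 := fun e =>
          absurd (hEM _ _ hy.1 (h.initial y hy e).2.1) (not_le.2 hlt)
        obtain ⟨X, t₁, ht₁, ht, hXx, hX, hXle⟩ := h.exists_backward_slow hb.le hab hy h0
        have hXy : (X y.2, y.2) = y := by rw [hXx]
        obtain ⟨t, ht', hgt⟩ := h.sol.swap.exists_wgrad_gt hs.swap hb hab (hΛ z w hs.swap) hX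
          ht₁ ht (by rwa [hXy]) (by rwa [hXy])
        rw [hXy] at hgt
        exact ⟨(X t, t), hX.mem t ht', ht'.2, hXle t ht', hgt.trans_le
          (mul_le_mul_of_nonneg_left (le_max_right _ _) (hE0 t).le)⟩
  have hEinv : ∀ y, E x.2 * y ≤ M → y ≤ M * Real.exp ((2 * Λ + 1) * x.2) := fun y hy => by
    have e : E x.2 = (Real.exp ((2 * Λ + 1) * x.2))⁻¹ := by
      rw [hE, ← Real.exp_neg]; simp only [neg_mul]
    rwa [e, inv_mul_le_iff₀ (Real.exp_pos _), mul_comm] at hy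
  exact ⟨hEinv _ ((mul_le_mul_of_nonneg_left (le_max_left _ _) (hE0 _).le).trans key),
    hEinv _ ((mul_le_mul_of_nonneg_left (le_max_right _ _) (hE0 _).le).trans key)⟩

/-- The density does not decay faster than exponentially: along the fast characteristics
`log (w - z)` decreases at a rate that an upper bound on the slow gradient variable controls. -/
theorem log_sub_ge {Λ Mβ T : ℝ} (h : IsAdmissible a b κ b₀ W M H T₀ B B' w z) (hb : 0 < b)
    (hab : b < a) (hκ : 0 < κ) (hH : 0 < H) (hC0 : 0 ≤ (a - b) * Mβ + Λ)
    (hΛ : ∀ x ∈ region B T₀,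
      κ / x.1 * ((w x + z x) * (1 + (a * w x + b * z x) / (a * z x + b * w x))) ≤ Λ)
    (hβ : ∀ x ∈ region B T₀, x.2 ≤ T → grad a b (region B T₀) z w x ≤ Mβ) :
    ∀ x ∈ region B T₀, x.2 ≤ T →
      Real.log H - ((a - b) * Mβ + Λ + 1) * x.2 ≤ Real.log (w x - z x) := by
  have ha := hb.trans hab
  have hs := h.stateRange hb hab hκ
  set C := (a - b) * Mβ + Λ + 1 with hC
  set f : ℝ × ℝ → ℝ := fun x => -(Real.log (w x - z x) + C * x.2) with hf
  have h1 := h.sol.contDiffOn_left.continuousOn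
  have h2 := h.sol.contDiffOn_right.continuousOn
  have hpos : ∀ x ∈ region B T₀, 0 < w x - z x := fun x hx => sub_pos.2 (h.lt x hx)
  have hfc : ContinuousOn f (region B T₀) :=
    (((h1.sub h2).log fun x hx => (hpos x hx).ne').add
      (continuousOn_const.mul continuousOn_snd)).neg
  have hdat : ∀ x : ℝ × ℝ, 0 ≤ x.2 → H ≤ w x - z x → f x ≤ -Real.log H := fun x hx hH' => by
    have := Real.log_le_log hH hH'
    have : 0 ≤ C * x.2 := mul_nonneg (by linarith) hx
    simp only [hf]; linarith
  have key : ∀ x ∈ region B T₀, x.2 ≤ T → f x ≤ -Real.log H := by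
    refine le_of_exists_gt h.continuousOn_boundary hfc fun x hx hxT hlt => ?_
    obtain ⟨h0, hside⟩ := h.ne_data (f := f)
      (fun x hx h0 => hdat x hx.1 (h.initial x hx h0).2.2.1)
      (fun hs t ht => hdat _ ht.1 (hs t ht).2.1) hx hlt
    obtain ⟨X, t₁, ht₁, ht, hXx, hX, hXle⟩ := h.exists_backward_fast ha.le hb.le hx h0 hside
    have hcd : ContinuousOn (fun x : ℝ × ℝ => κ / x.1 * ((w x + z x) *
        (1 + (a * w x + b * z x) / (a * z x + b * w x)))) (region B T₀) := by
      have hU : ∀ x ∈ region B T₀, a * z x + b * w x ≠ 0 := fun x hx =>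
        (hs.swap.speed_pos hx ha hb).ne'
      have c1 : ContinuousOn (fun x : ℝ × ℝ => κ / x.1) (region B T₀) :=
        continuousOn_const.div continuousOn_fst fun x hx => (h.sol.radius_pos x hx).ne'
      fun_prop (disch := assumption)
    have hrate := ((((continuousOn_const (c := a - b)).mul
      (h.sol.swap.continuousOn_grad hs.swap ha hb)).neg.sub hcd).add
      (continuousOn_const (c := C))).neg
    obtain ⟨t, ht', hgt⟩ := exists_gt_of_hasDerivAt_neg (f := fun t => f (X t, t)) ht
      (hX.continuousOn_comp hfc)
      (fun t ht => by
        have hm := hX.mem t (Ioo_subset_Icc_self ht)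
        have := ((h.sol.hasDerivAt_log_sub hX ht (hs.ne _ hm)
          (hs.swap.speed_pos hm ha hb).ne').add ((hasDerivAt_id t).const_mul C)).neg
        rw [mul_one] at this
        exact this)
      (hX.continuousOn_comp hrate) (by
        have hm := hX.mem x.2 (right_mem_Icc.2 ht.le)
        have q1 := hΛ _ hm
        have q2 := mul_le_mul_of_nonneg_left (hβ _ hm hxT) (by linarith : 0 ≤ a - b)
        simp only [Pi.neg_apply, Pi.add_apply, Pi.sub_apply, Pi.mul_apply] at q1 q2 ⊢
        linarith)
    rw [hXx] at hgt
    exact ⟨(X t, t), hX.mem t ht', ht'.2, hXle t ht', hgt⟩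
  intro x hx hxT
  have := key x hx hxT
  simp only [hf] at this
  linarith

end IsAdmissible

/-- Uniform threshold: no characteristic of either family that carries a sufficiently negative
gradient variable stays in the domain for a time `η`. -/
theorem exists_threshold {a b κ b₀ W M H T η : ℝ} (hb : 0 < b) (hab : b < a) (hab1 : a + b = 1)
    (hκ : 0 < κ) (hb₀ : 0 < b₀) (hM : 0 < M) (hH : 0 < H) (hη : 0 < η) :
    ∃ N : ℝ, 0 < N ∧ ∀ (T₀ : ℝ) (B B' : ℝ → ℝ) (w z : ℝ × ℝ → ℝ),
      IsAdmissible a b κ b₀ W M H T₀ B B' w z → ∀ (X : ℝ → ℝ) (t₁ : ℝ), 0 ≤ t₁ → t₁ + η ≤ T →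
      (IsCharacteristic (fun x => a * w x + b * z x) (region B T₀) X t₁ (t₁ + η) →
        -N < grad a b (region B T₀) w z (X t₁, t₁)) ∧
      (IsCharacteristic (fun x => a * z x + b * w x) (region B T₀) X t₁ (t₁ + η) →
        -N < grad a b (region B T₀) z w (X t₁, t₁)) := by
  have ha := hb.trans hab
  have hk : 0 < b / (a - b) := div_pos hb (by linarith)
  obtain ⟨Λ, hΛ0, hΛ⟩ := exists_coeff_bound (W := W) hb hab hab1 hκ hb₀
  set g₀ := Real.exp (-(b / (a - b)) * Real.log W) with hg₀
  set M₁ := M * Real.exp ((2 * Λ + 1) * T) with hM₁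
  set C := (a - b) * (M₁ / g₀) + Λ + 1 with hC
  set g₁ := Real.exp (-(b / (a - b)) * (Real.log H - C * T)) with hg₁
  have hM₁0 : 0 < M₁ := by positivity
  have hg₀0 : 0 < g₀ := Real.exp_pos _
  have hg₁0 : 0 < g₁ := Real.exp_pos _
  refine ⟨(1 + 2 * Λ * (1 + M₁) * g₁ / a + 2 * g₁ / (a * η) + 1) / g₀, by positivity, ?_⟩
  intro T₀ B B' w z h X t₁ ht₁ htT
  have hs := h.stateRange hb hab hκ
  have hw : ∀ x ∈ region B T₀, x.2 ≤ T → wgrad a b (region B T₀) w z x ≤ M₁ ∧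
      wgrad a b (region B T₀) z w x ≤ M₁ := by
    intro x hx hxT
    have h1 := h.wgrad_le hb hab hκ hM (fun p q hpq x hx =>
      ⟨(hΛ _ p q hpq x hx).1, (hΛ _ p q hpq x hx).2.1, (hΛ _ p q hpq x hx).2.2.1⟩) x hx
    have h2 : M * Real.exp ((2 * Λ + 1) * x.2) ≤ M₁ := by
      rw [hM₁]; gcongr
    exact ⟨h1.1.trans h2, h1.2.trans h2⟩
  have hg₀w : ∀ x ∈ region B T₀, g₀ ≤ weight a b w z x := fun x hx => hs.le_weight hx hb hab
  have hβ : ∀ x ∈ region B T₀, x.2 ≤ T → grad a b (region B T₀) z w x ≤ M₁ / g₀ := by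
    intro x hx hxT
    rw [le_div_iff₀ hg₀0]
    rcases le_total 0 (grad a b (region B T₀) z w x) with h0 | h0
    · calc grad a b (region B T₀) z w x * g₀
          ≤ grad a b (region B T₀) z w x * weight a b z w x := by
            rw [weight_comm]; gcongr; exact hg₀w x hx
        _ ≤ M₁ := (hw x hx hxT).2
    · nlinarith
  have hC0 : 0 ≤ (a - b) * (M₁ / g₀) + Λ := by
    have : 0 < a - b := by linarith
    positivity
  have hlog := h.log_sub_ge hb hab hκ hH hC0 (fun x hx => (hΛ _ w z hs x hx).2.2.2) hβ
  have hg₁w : ∀ x ∈ region B T₀, x.2 ≤ T → weight a b w z x ≤ g₁ := by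
    intro x hx hxT
    rw [weight, hg₁, Real.exp_le_exp]
    have h1 := hlog x hx hxT
    have h2 : C * x.2 ≤ C * T := by gcongr
    have h3 : Real.log H - C * T ≤ Real.log (w x - z x) := by linarith
    nlinarith
  have hsub : ∀ t ∈ Icc t₁ (t₁ + η), t ≤ T := fun t ht => ht.2.trans htT
  constructor
  · intro hX
    by_contra! hle
    exact h.sol.false_of_grad_le hs hb hab (fun x hx =>
      ⟨(hΛ _ w z hs x hx).1, (hΛ _ w z hs x hx).2.1, (hΛ _ w z hs x hx).2.2.1⟩) hX ht₁ hη hM₁0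
      hg₀0 hg₁0 (fun t ht => (hw _ (hX.mem t ht) (hsub t ht)).2) hg₀w
      (fun t ht => hg₁w _ (hX.mem t ht) (hsub t ht)) hle
  · intro hX
    by_contra! hle
    refine h.sol.swap.false_of_grad_le hs.swap hb hab (fun x hx =>
      ⟨(hΛ _ z w hs.swap x hx).1, (hΛ _ z w hs.swap x hx).2.1, (hΛ _ z w hs.swap x hx).2.2.1⟩)
      hX ht₁ hη hM₁0 hg₀0 hg₁0 (fun t ht => (hw _ (hX.mem t ht) (hsub t ht)).1)
      (fun x hx => by rw [weight_comm]; exact hg₀w x hx)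
      (fun t ht => by rw [weight_comm]; exact hg₁w _ (hX.mem t ht) (hsub t ht)) hle

/-! ### The Euler equations in Riemann invariants -/

/-- The Riemann invariant `u + 2 h / (γ - 1)`. -/
def riemannFast (γ K : ℝ) (ρ u : ℝ × ℝ → ℝ) (x : ℝ × ℝ) : ℝ :=
  u x + 2 / (γ - 1) * soundSpeed γ K ρ x

/-- The Riemann invariant `u - 2 h / (γ - 1)`. -/
def riemannSlow (γ K : ℝ) (ρ u : ℝ × ℝ → ℝ) (x : ℝ × ℝ) : ℝ :=
  u x - 2 / (γ - 1) * soundSpeed γ K ρ x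

section

variable {γ K : ℝ} {m : ℕ} {Ω : Set (ℝ × ℝ)} {ρ u : ℝ × ℝ → ℝ} {x : ℝ × ℝ}

theorem c₂_eq (hγ₁ : 1 < γ) (x : ℝ × ℝ) : c₂ γ K ρ u x
    = (γ + 1) / 4 * riemannFast γ K ρ u x + (3 - γ) / 4 * riemannSlow γ K ρ u x := by
  have : γ - 1 ≠ 0 := by linarith
  rw [c₂, riemannFast, riemannSlow]; field_simp; ring

theorem c₁_eq (hγ₁ : 1 < γ) (x : ℝ × ℝ) : c₁ γ K ρ u x
    = (γ + 1) / 4 * riemannSlow γ K ρ u x + (3 - γ) / 4 * riemannFast γ K ρ u x := by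
  have : γ - 1 ≠ 0 := by linarith
  rw [c₁, riemannFast, riemannSlow]; field_simp; ring

theorem _root_.HasFDerivWithinAt.dt_eq {f : ℝ × ℝ → ℝ} {f' : ℝ × ℝ →L[ℝ] ℝ}
    (h : HasFDerivWithinAt f f' Ω x) (hΩ : UniqueDiffWithinAt ℝ Ω x) :
    dt Ω f x = f' (0, 1) := by rw [dt, h.fderivWithin hΩ]

theorem _root_.HasFDerivWithinAt.dr_eq {f : ℝ × ℝ → ℝ} {f' : ℝ × ℝ →L[ℝ] ℝ}
    (h : HasFDerivWithinAt f f' Ω x) (hΩ : UniqueDiffWithinAt ℝ Ω x) :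
    dr Ω f x = f' (1, 0) := by rw [dr, h.fderivWithin hΩ]

theorem hasFDerivWithinAt_radius_pow_mul {f : ℝ × ℝ → ℝ} {f' : ℝ × ℝ →L[ℝ] ℝ} (m : ℕ)
    (hf : HasFDerivWithinAt f f' Ω x) (hx : 0 < x.1) :
    HasFDerivWithinAt (fun q : ℝ × ℝ => q.1 ^ m * f q)
      (x.1 ^ m • f' + (m * x.1 ^ m / x.1 * f x) • ContinuousLinearMap.fst ℝ ℝ ℝ) Ω x := by
  have h1 : HasFDerivWithinAt (fun q : ℝ × ℝ => q.1 ^ m)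
      (((m : ℝ) * x.1 ^ (m - 1)) • ContinuousLinearMap.fst ℝ ℝ ℝ) Ω x :=
    (hasDerivAt_pow m x.1).comp_hasFDerivWithinAt x hasFDerivWithinAt_fst
  refine (h1.mul hf).congr_fderiv ?_
  have e : (m : ℝ) * x.1 ^ (m - 1) = m * x.1 ^ m / x.1 := by
    cases m with
    | zero => simp
    | succ n => field_simp; simp [pow_succ]
  rw [e, smul_smul, mul_comm (f x)]

theorem soundSpeed_sq (hγ₁ : 1 < γ) (hK : 0 < K) (hρ : 0 ≤ ρ x) :
    soundSpeed γ K ρ x ^ 2 = K * γ * ρ x ^ (γ - 1) := by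
  rw [soundSpeed, mul_pow, Real.sq_sqrt (by positivity), ← Real.rpow_natCast, ← Real.rpow_mul hρ]
  congr 2
  push_cast; ring

theorem soundSpeed_pos (hγ₁ : 1 < γ) (hK : 0 < K) (hρ : 0 < ρ x) : 0 < soundSpeed γ K ρ x :=
  mul_pos (Real.sqrt_pos.2 (by positivity)) (Real.rpow_pos_of_pos hρ _)

theorem hasFDerivWithinAt_soundSpeed {D : ℝ × ℝ →L[ℝ] ℝ} (hD : HasFDerivWithinAt ρ D Ω x)
    (hρ : 0 < ρ x) : HasFDerivWithinAt (soundSpeed γ K ρ)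
      (((γ - 1) / 2 * (soundSpeed γ K ρ x / ρ x)) • D) Ω x := by
  have h := (hD.rpow_const (p := (γ - 1) / 2) (Or.inl hρ.ne')).const_mul (Real.sqrt (K * γ))
  refine h.congr_fderiv ?_
  rw [smul_smul, soundSpeed, Real.rpow_sub_one hρ.ne']
  congr 1
  ring

/-- The continuity equation, divided by `r ^ m`. -/
theorem IsClassicalSolution.density_eq (h : IsClassicalSolution γ K m Ω ρ u)
    (hΩ : UniqueDiffWithinAt ℝ Ω x) (hx : x ∈ Ω) :
    dt Ω ρ x + u x * dr Ω ρ x = -(dr Ω u x + m * u x / x.1) * ρ x := by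
  have hr := h.radius_pos x hx
  have hρ := (h.contDiffOn_density.differentiableOn one_ne_zero x hx).hasFDerivWithinAt
  have hu := (h.contDiffOn_velocity.differentiableOn one_ne_zero x hx).hasFDerivWithinAt
  have e := h.mass x hx
  have h1 := hasFDerivWithinAt_radius_pow_mul m hρ hr
  have h2 : HasFDerivWithinAt (fun q => q.1 ^ m * ρ q * u q) _ Ω x := h1.mul hu
  rw [h1.dt_eq hΩ, h2.dr_eq hΩ] at e
  simp only [add_apply, smul_apply,
    ContinuousLinearMap.coe_fst', smul_eq_mul] at e
  rw [← dr, ← dr, ← dt] at e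
  have hrm : x.1 ^ m ≠ 0 := (pow_pos hr m).ne'
  have hr' := hr.ne'
  generalize x.1 ^ m = G at e hrm
  field_simp at e ⊢
  refine mul_left_cancel₀ hrm ?_
  linear_combination e

/-- The momentum equation in terms of the velocity. -/
theorem IsClassicalSolution.velocity_eq (h : IsClassicalSolution γ K m Ω ρ u) (hγ₁ : 1 < γ)
    (hK : 0 < K) (hΩ : UniqueDiffWithinAt ℝ Ω x) (hx : x ∈ Ω) (hpos : 0 < ρ x) :
    dt Ω u x + u x * dr Ω u x = -(soundSpeed γ K ρ x ^ 2 / ρ x * dr Ω ρ x) := by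
  have hr := h.radius_pos x hx
  have hρ := (h.contDiffOn_density.differentiableOn one_ne_zero x hx).hasFDerivWithinAt
  have hu := (h.contDiffOn_velocity.differentiableOn one_ne_zero x hx).hasFDerivWithinAt
  have e := h.momentum x hx
  have e' := h.density_eq hΩ hx
  have h1 := hasFDerivWithinAt_radius_pow_mul m hρ hr
  have h2 := (hρ.rpow_const (p := γ) (Or.inl hpos.ne')).const_mul K
  have h3 : dr Ω (pressure γ K ρ) x = soundSpeed γ K ρ x ^ 2 * dr Ω ρ x := by
    rw [show pressure γ K ρ = fun q => K * ρ q ^ γ from rfl, h2.dr_eq hΩ,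
      soundSpeed_sq hγ₁ hK hpos.le]
    simp only [smul_apply, smul_eq_mul]
    rw [← dr]; ring
  have h4 : HasFDerivWithinAt (fun q => q.1 ^ m * ρ q * u q) _ Ω x := h1.mul hu
  have h5 : HasFDerivWithinAt (fun q => q.1 ^ m * ρ q * u q ^ 2) _ Ω x := h1.mul (hu.pow 2)
  rw [h4.dt_eq hΩ, h5.dr_eq hΩ, h3] at e
  simp only [add_apply, smul_apply,
    ContinuousLinearMap.coe_fst', smul_eq_mul, nsmul_eq_mul] at e
  rw [← dr, ← dr, ← dt, ← dt] at e
  have hrm : x.1 ^ m ≠ 0 := (pow_pos hr m).ne'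
  have e'' : dt Ω ρ x = -(dr Ω u x + m * u x / x.1) * ρ x - u x * dr Ω ρ x := by linarith
  rw [e''] at e
  have hr' := hr.ne'
  generalize x.1 ^ m = G at e hrm
  field_simp at e ⊢
  refine mul_left_cancel₀ hr' ?_
  norm_num at e
  linear_combination e.resolve_left hrm

theorem riemann_derivs {D E : ℝ × ℝ →L[ℝ] ℝ} (hγ₁ : 1 < γ) (hD : HasFDerivWithinAt ρ D Ω x)
    (hE : HasFDerivWithinAt u E Ω x) (hρ : 0 < ρ x) :
    HasFDerivWithinAt (riemannFast γ K ρ u) (E + (soundSpeed γ K ρ x / ρ x) • D) Ω x ∧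
    HasFDerivWithinAt (riemannSlow γ K ρ u) (E - (soundSpeed γ K ρ x / ρ x) • D) Ω x := by
  have h1 := (hasFDerivWithinAt_soundSpeed (γ := γ) (K := K) hD hρ).const_mul (2 / (γ - 1))
  have e : 2 / (γ - 1) * ((γ - 1) / 2 * (soundSpeed γ K ρ x / ρ x))
      = soundSpeed γ K ρ x / ρ x := by
    have : γ - 1 ≠ 0 := by linarith
    field_simp
  rw [smul_smul, e] at h1
  exact ⟨hE.add h1, hE.sub h1⟩

/-- Where the density is positive, the Euler equations are the diagonal system of the Riemann
invariants, and the gradient variables are their time derivatives, divided by the speeds. -/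
theorem IsClassicalSolution.riemann_eq (h : IsClassicalSolution γ K m Ω ρ u) (hγ₁ : 1 < γ)
    (hK : 0 < K) (hΩ : UniqueDiffWithinAt ℝ Ω x) (hx : x ∈ Ω) (hpos : 0 < ρ x) :
    dt Ω (riemannFast γ K ρ u) x + c₂ γ K ρ u x * dr Ω (riemannFast γ K ρ u) x
      = -(m * soundSpeed γ K ρ x * u x / x.1) ∧
    dt Ω (riemannSlow γ K ρ u) x + c₁ γ K ρ u x * dr Ω (riemannSlow γ K ρ u) x
      = m * soundSpeed γ K ρ x * u x / x.1 ∧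
    alpha γ K m Ω ρ u x = -dt Ω (riemannFast γ K ρ u) x / c₂ γ K ρ u x ∧
    beta γ K m Ω ρ u x = -dt Ω (riemannSlow γ K ρ u) x / c₁ γ K ρ u x := by
  have hr := h.radius_pos x hx
  have hρ := (h.contDiffOn_density.differentiableOn one_ne_zero x hx).hasFDerivWithinAt
  have hu := (h.contDiffOn_velocity.differentiableOn one_ne_zero x hx).hasFDerivWithinAt
  have e1 := h.density_eq hΩ hx
  have e2 := h.velocity_eq hγ₁ hK hΩ hx hpos
  obtain ⟨hw, hz⟩ := riemann_derivs (K := K) hγ₁ hρ hu hpos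
  have hf := (hasFDerivWithinAt_radius_pow_mul m hρ hr).mul hu
  have hfl : massFlux m ρ u = (fun q : ℝ × ℝ => q.1 ^ m * ρ q) * u := rfl
  rw [alpha, beta, hfl, hf.dt_eq hΩ, hf.dr_eq hΩ, hw.dt_eq hΩ, hw.dr_eq hΩ, hz.dt_eq hΩ,
    hz.dr_eq hΩ, c₁, c₂]
  simp only [add_apply, sub_apply,
    smul_apply, ContinuousLinearMap.coe_fst', smul_eq_mul]
  rw [← dr, ← dr, ← dt, ← dt]
  have hrm : x.1 ^ m ≠ 0 := (pow_pos hr m).ne'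
  have e1' : dt Ω ρ x = -(dr Ω u x + m * u x / x.1) * ρ x - u x * dr Ω ρ x := by linarith
  have e2' : dt Ω u x = -(soundSpeed γ K ρ x ^ 2 / ρ x * dr Ω ρ x) - u x * dr Ω u x := by
    linarith
  rw [e1', e2']
  have hne := hpos.ne'
  generalize soundSpeed γ K ρ x = s
  generalize dr Ω ρ x = ρr
  generalize dr Ω u x = ur
  refine ⟨?_, ?_, ?_, ?_⟩
  · field_simp; ring
  · field_simp; ring
  · rw [← mul_div_mul_left _ (u x + s) (mul_ne_zero hrm hne)]
    congr 1
    field_simp; ring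
  · rw [← mul_div_mul_left _ (u x - s) (mul_ne_zero hrm hne)]
    congr 1
    field_simp; ring

end

/-! ### Positivity of the density and of the slow Riemann invariant -/

theorem continuousOn_soundSpeed {γ K : ℝ} {Ω : Set (ℝ × ℝ)} {ρ : ℝ × ℝ → ℝ} (hγ₁ : 1 < γ)
    (hρ : ContinuousOn ρ Ω) : ContinuousOn (soundSpeed γ K ρ) Ω :=
  continuousOn_const.mul (hρ.rpow_const fun _ _ => Or.inr (by linarith))

/-- A function that is larger on a backward line segment than at its end point does not increase
in the direction of the segment. -/
theorem directional_nonpos {Ω : Set (ℝ × ℝ)} {f : ℝ × ℝ → ℝ} {r₀ t₀ s v φ' : ℝ} {φ : ℝ → ℝ}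
    (hs : s < t₀) (hf : DifferentiableWithinAt ℝ f Ω (r₀, t₀)) (hφ : HasDerivAt φ φ' t₀)
    (hmem : ∀ t ∈ Icc s t₀, (r₀ - v * (t₀ - t), t) ∈ Ω)
    (hlt : ∀ t ∈ Ico s t₀, φ t < f (r₀ - v * (t₀ - t), t)) (h₀ : f (r₀, t₀) ≤ φ t₀) :
    dt Ω f (r₀, t₀) + v * dr Ω f (r₀, t₀) ≤ φ' := by
  have hX : HasDerivWithinAt (fun t => r₀ - v * (t₀ - t)) v (Icc s t₀) t₀ := by
    have := (((hasDerivWithinAt_id t₀ (Icc s t₀)).const_sub t₀).const_mul v).const_sub r₀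
    simpa using this
  have e : r₀ - v * (t₀ - t₀) = r₀ := by ring
  have hg := hasDerivWithinAt_comp_path (Y := fun t => t) (by rwa [e]) hX
    (hasDerivWithinAt_id t₀ _) hmem
  have hg' := hg.sub hφ.hasDerivWithinAt
  rw [hasDerivWithinAt_iff_tendsto_slope, e] at hg'
  have hne : (𝓝[Icc s t₀ \ {t₀}] t₀).NeBot := by
    rw [Icc_sdiff_right, nhdsWithin_Ico_eq_nhdsLT hs]; infer_instance
  refine sub_nonpos.1 (le_of_tendsto hg' ?_)
  filter_upwards [self_mem_nhdsWithin] with t ht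
  rw [Icc_sdiff_right] at ht
  have h1 := hlt t ht
  rw [slope_def_field]
  refine div_nonpos_of_nonneg_of_nonpos ?_ (by linarith [ht.2])
  simp only [Pi.sub_apply, e]
  linarith

/-- A backward line segment from a point of the domain stays in the domain for a short time, if
the point lies off the lateral boundary or the lateral boundary is faster there. -/
theorem exists_backward_segment {B : ℝ → ℝ} {T₀ r₀ t₀ v B' : ℝ} (ht₀ : 0 < t₀)
    (h₀ : (r₀, t₀) ∈ region B T₀) (hB : HasDerivWithinAt B B' (Ico 0 T₀) t₀)
    (hside : v < B' ∨ B t₀ < r₀) :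
    ∃ s, 0 ≤ s ∧ s < t₀ ∧ ∀ t ∈ Icc s t₀, (r₀ - v * (t₀ - t), t) ∈ region B T₀ := by
  obtain ⟨-, hT, hr⟩ := h₀
  simp only at hT hr
  have hev : ∃ ε > 0, ∀ t, 0 ≤ t → t < t₀ → t₀ - ε < t → B t ≤ r₀ - v * (t₀ - t) := by
    rcases hside with hv | hlt
    · rw [hasDerivWithinAt_iff_tendsto_slope] at hB
      have hev := hB.eventually (lt_mem_nhds hv)
      rw [eventually_nhdsWithin_iff, Metric.eventually_nhds_iff] at hev
      obtain ⟨ε, hε, hev⟩ := hev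
      refine ⟨ε, hε, fun t h0 h1 h2 => ?_⟩
      have := hev (y := t) (by rw [Real.dist_eq, abs_lt]; constructor <;> linarith)
        ⟨⟨h0, h1.trans hT⟩, by simpa using h1.ne⟩
      rw [slope_def_field, lt_div_iff_of_neg (by linarith)] at this
      linarith
    · have hc : ContinuousWithinAt (fun t => r₀ - v * (t₀ - t)) (Ico 0 T₀) t₀ := by fun_prop
      have hev := hB.continuousWithinAt.tendsto.eventually_lt hc (by simpa using hlt)
      rw [eventually_nhdsWithin_iff, Metric.eventually_nhds_iff] at hev
      obtain ⟨ε, hε, hev⟩ := hev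
      refine ⟨ε, hε, fun t h0 h1 h2 => (hev (y := t) ?_ ⟨h0, h1.trans hT⟩).le⟩
      rw [Real.dist_eq, abs_lt]; constructor <;> linarith
  obtain ⟨ε, hε, hev⟩ := hev
  refine ⟨max 0 (t₀ - ε / 2), le_max_left _ _, max_lt ht₀ (by linarith), fun t ht => ?_⟩
  have h0 := (le_max_left _ _).trans ht.1
  have h1 := (le_max_right _ _).trans ht.1
  refine ⟨h0, ht.2.trans_lt hT, ?_⟩
  rcases ht.2.eq_or_lt with e | e
  · simp only [e]; linarith
  · exact hev t h0 e (by linarith)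

/-- On a trapezoid, the density stays above an exponentially decaying barrier and the slow Riemann
invariant above `-ε`. At the first time where this fails the velocity and the slow speed
are positive, because the density is still above the barrier and `ε` is small, so that the backward line segments in these two directions
do not leave the trapezoid through its right edge; along them the density grows faster than the
barrier and the slow invariant increases. -/
theorem barrier {γ K : ℝ} {m : ℕ} {T₀ ρlow : ℝ} {B B' : ℝ → ℝ} {ρ u : ℝ × ℝ → ℝ}
    (hγ₁ : 1 < γ) (hγ₃ : γ < 3) (hK : 0 < K) (hm : 0 < m) (hρlow : 0 < ρlow)
    (h : IsClassicalSolution γ K m (region B T₀) ρ u)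
    (hB : ∀ t ∈ Ico 0 T₀, HasDerivWithinAt B (B' t) (Ico 0 T₀) t)
    (h₀ : ∀ x ∈ region B T₀, x.2 = 0 → ρlow ≤ ρ x ∧ 0 ≤ riemannSlow γ K ρ u x)
    (hside : (∀ t ∈ Ico 0 T₀, B' t = c₂ γ K ρ u (B t, t)) ∨
      ∀ t ∈ Ico 0 T₀, ρlow ≤ ρ (B t, t) ∧ 0 ≤ riemannSlow γ K ρ u (B t, t))
    {τ R : ℝ} (hτ : τ < T₀) (hR : ∀ t ∈ Icc 0 τ, B t ≤ R) :
    ∃ ε₀ > 0, ∀ ε, 0 < ε → ε ≤ ε₀ → ∀ x ∈ trapezoid B τ R,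
      0 < ρ x ∧ -ε < riemannSlow γ K ρ u x := by
  set D := trapezoid B τ R with hD
  have hsubt : Icc 0 τ ⊆ Ico 0 T₀ := fun t ht => ⟨ht.1, ht.2.trans_lt hτ⟩
  have hBc : ContinuousOn B (Icc 0 τ) := fun t ht =>
    ((hB t (hsubt ht)).continuousWithinAt).mono hsubt
  have hDc : IsCompact D := isCompact_trapezoid R hBc
  have hDΩ : D ⊆ region B T₀ := trapezoid_subset_region hτ
  have hΩ := uniqueDiffOn_region hB
  have cρ := h.contDiffOn_density.continuousOn
  have cu := h.contDiffOn_velocity.continuousOn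
  have cz : ContinuousOn (riemannSlow γ K ρ u) (region B T₀) :=
    cu.sub (continuousOn_const.mul (continuousOn_soundSpeed hγ₁ cρ))
  have crate : ContinuousOn (fun x : ℝ × ℝ => dr (region B T₀) u x + m * u x / x.1)
      (region B T₀) :=
    (continuousOn_dr hΩ h.contDiffOn_velocity).add
      ((continuousOn_const.mul cu).div continuousOn_fst fun x hx => (h.radius_pos x hx).ne')
  obtain ⟨L, hL⟩ := hDc.exists_bound_of_continuousOn (crate.mono hDΩ)
  set φ : ℝ → ℝ := fun t => ρlow / 2 * Real.exp (-(|L| + 1) * t) with hφ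
  have hφ0 : ∀ t, 0 < φ t := fun t => by positivity
  have hφd : ∀ t, HasDerivAt φ (-(|L| + 1) * φ t) t := fun t => by
    refine ((((hasDerivAt_id t).const_mul (-(|L| + 1))).exp).const_mul (ρlow / 2)).congr_deriv ?_
    simp only [hφ, id]; ring
  have hφanti : ∀ t, t ≤ τ → φ τ ≤ φ t := fun t ht => by
    simp only [hφ]
    have : -(|L| + 1) * τ ≤ -(|L| + 1) * t := by nlinarith [abs_nonneg L]
    gcongr
  have hφlow : ∀ t, 0 ≤ t → φ t < ρlow := fun t ht => by
    have : Real.exp (-(|L| + 1) * t) ≤ 1 := by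
      rw [Real.exp_le_one_iff]; nlinarith [abs_nonneg L]
    simp only [hφ]; nlinarith
  -- lower bound on the sound speed as long as the density stays above the barrier
  set s₀ := Real.sqrt (K * γ) * φ τ ^ ((γ - 1) / 2) with hs₀
  have hs₀0 : 0 < s₀ := mul_pos (Real.sqrt_pos.2 (by positivity)) (Real.rpow_pos_of_pos (hφ0 τ) _)
  have hg1 : 0 < γ - 1 := by linarith
  have hg3 : 0 < (3 - γ) / (γ - 1) := div_pos (by linarith) hg1
  have hg : 2 / (γ - 1) = 1 + (3 - γ) / (γ - 1) := by field_simp; ring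
  refine ⟨(3 - γ) / (γ - 1) * s₀ / 2, by positivity, fun ε hε hεle => ?_⟩
  have hgood : ∀ x : ℝ × ℝ, x.2 ≤ τ → φ x.2 ≤ ρ x → -ε ≤ riemannSlow γ K ρ u x →
      0 < ρ x ∧ 0 < soundSpeed γ K ρ x ∧ 0 < u x ∧ 0 < c₁ γ K ρ u x := by
    intro x hx hρx hz
    have h1 : s₀ ≤ soundSpeed γ K ρ x := by
      rw [hs₀, soundSpeed]
      gcongr
      exact (hφanti _ hx).trans hρx
    have h2 : (3 - γ) / (γ - 1) * s₀ ≤ (3 - γ) / (γ - 1) * soundSpeed γ K ρ x := by gcongr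
    rw [riemannSlow, hg] at hz
    rw [c₁]
    have h3 : 0 < (3 - γ) / (γ - 1) * s₀ := by positivity
    exact ⟨(hφ0 _).trans_le hρx, by linarith, by linarith, by linarith⟩
  suffices hsuff : ∀ x ∈ D, ¬ (ρ x ≤ φ x.2 ∨ riemannSlow γ K ρ u x ≤ -ε) by
    intro x hx
    have := hsuff x hx
    push Not at this
    exact ⟨(hφ0 _).trans this.1, this.2⟩
  by_contra! hbad
  obtain ⟨x₁, hx₁, hx₁b⟩ := hbad
  -- the first time at which one of the two bounds fails
  have hcφ : Continuous φ := by fun_prop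
  have hScl : IsCompact {x | x ∈ D ∧ (ρ x ≤ φ x.2 ∨ riemannSlow γ K ρ u x ≤ -ε)} := by
    have hc1 : IsClosed {x | x ∈ D ∧ ρ x ≤ φ x.2} :=
      IsClosed.isClosed_le hDc.isClosed (cρ.mono hDΩ) (hcφ.comp continuous_snd).continuousOn
    have hc2 : IsClosed {x | x ∈ D ∧ riemannSlow γ K ρ u x ≤ -ε} :=
      IsClosed.isClosed_le hDc.isClosed (cz.mono hDΩ) continuousOn_const
    have : {x | x ∈ D ∧ (ρ x ≤ φ x.2 ∨ riemannSlow γ K ρ u x ≤ -ε)}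
        = {x | x ∈ D ∧ ρ x ≤ φ x.2} ∪ {x | x ∈ D ∧ riemannSlow γ K ρ u x ≤ -ε} := by
      ext x; simp only [mem_ofPred_eq, mem_union]; tauto
    rw [this]
    exact hDc.of_isClosed_subset (hc1.union hc2)
      (union_subset (fun x hx => hx.1) fun x hx => hx.1)
  obtain ⟨⟨r₀, t₀⟩, ⟨hP, hPb⟩, hmin⟩ :=
    hScl.exists_isMinOn ⟨x₁, hx₁, hx₁b⟩ continuous_snd.continuousOn
  have hearly : ∀ x ∈ D, x.2 < t₀ → φ x.2 < ρ x ∧ -ε < riemannSlow γ K ρ u x := by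
    intro x hx hxt
    by_contra hcon
    have : t₀ ≤ x.2 := hmin (a := x) ⟨hx, by
      by_contra hno; push Not at hno; exact hcon hno⟩
    linarith
  have hPΩ := hDΩ hP
  obtain ⟨h0t, htτ, hBr, hrR⟩ := hP
  simp only at h0t htτ hBr hrR hPb
  have ht₀ : 0 < t₀ := by
    refine lt_of_le_of_ne h0t fun e => ?_
    obtain ⟨i1, i2⟩ := h₀ _ hPΩ e.symm
    rcases hPb with hb | hb
    · linarith [hφlow t₀ h0t]
    · linarith
  have ht₀I : t₀ ∈ Icc 0 τ := ⟨h0t, htτ⟩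
  -- by continuity both bounds hold, not strictly, at the first bad point
  have hlim : φ t₀ ≤ ρ (r₀, t₀) ∧ -ε ≤ riemannSlow γ K ρ u (r₀, t₀) := by
    have hpath : ∀ t ∈ Icc 0 t₀, (max (B t) r₀, t) ∈ D := fun t ht =>
      ⟨ht.1, ht.2.trans htτ, le_max_left _ _, max_le (hR t ⟨ht.1, ht.2.trans htτ⟩) hrR⟩
    have hsub : Icc 0 t₀ ⊆ Icc 0 τ := Icc_subset_Icc_right htτ
    have hpc : ContinuousOn (fun t => (max (B t) r₀, t)) (Icc 0 t₀) :=
      ((hBc.mono hsub).sup continuousOn_const).prodMk continuousOn_id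
    have e : max (B t₀) r₀ = r₀ := max_eq_right hBr
    have hlimf : ∀ f : ℝ × ℝ → ℝ, ContinuousOn f (region B T₀) →
        Tendsto (fun t => f (max (B t) r₀, t)) (𝓝[<] t₀) (𝓝 (f (r₀, t₀))) := by
      intro f hf
      have := (hf.comp hpc fun t ht => hDΩ (hpath t ht)) t₀ ⟨h0t, le_rfl⟩
      rw [ContinuousWithinAt, Function.comp_apply, e] at this
      refine this.mono_left ?_
      rw [← nhdsWithin_Ico_eq_nhdsLT ht₀]
      exact nhdsWithin_mono _ Ico_subset_Icc_self
    have hev : ∀ᶠ t in 𝓝[<] t₀, t ∈ Ico 0 t₀ := Ico_mem_nhdsLT ht₀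
    constructor
    · refine le_of_tendsto_of_tendsto ((hcφ.tendsto t₀).mono_left nhdsWithin_le_nhds)
        (hlimf ρ cρ) ?_
      filter_upwards [hev] with t ht
      exact (hearly _ (hpath t ⟨ht.1, ht.2.le⟩) ht.2).1.le
    · refine ge_of_tendsto (hlimf _ cz) ?_
      filter_upwards [hev] with t ht
      exact (hearly _ (hpath t ⟨ht.1, ht.2.le⟩) ht.2).2.le
  obtain ⟨hρ0, hs0, hu0, hc0⟩ := hgood (r₀, t₀) htτ hlim.1 hlim.2
  have hbd : c₂ γ K ρ u (r₀, t₀) = B' t₀ ∨ B t₀ < r₀ := by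
    rcases hBr.eq_or_lt with e | e
    · left
      rcases hside with hs | hs
      · rw [hs t₀ (hsubt ht₀I), e]
      · obtain ⟨i1, i2⟩ := hs t₀ (hsubt ht₀I)
        rw [e] at i1 i2
        rcases hPb with hb | hb
        · linarith [hφlow t₀ h0t]
        · linarith
    · exact Or.inr e
  -- backward segments with nonnegative speed less than the fast speed stay in the trapezoid
  have hseg : ∀ v, 0 ≤ v → v < c₂ γ K ρ u (r₀, t₀) → ∃ s, s < t₀ ∧
      ∀ t ∈ Icc s t₀, (r₀ - v * (t₀ - t), t) ∈ D := by
    intro v hv0 hv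
    obtain ⟨s, hs0, hst, hs⟩ := exists_backward_segment (v := v) ht₀ hPΩ (hB t₀ (hsubt ht₀I))
      (hbd.imp (fun e => hv.trans_eq e) id)
    refine ⟨s, hst, fun t ht => ⟨(hs t ht).1, ht.2.trans htτ, (hs t ht).2.2, ?_⟩⟩
    have := mul_nonneg hv0 (sub_nonneg.2 ht.2)
    simp only; linarith
  rcases hPb with hb | hb
  · obtain ⟨s, hst, hs⟩ := hseg (u (r₀, t₀)) hu0.le (by rw [c₂]; linarith)
    have := directional_nonpos hst (h.contDiffOn_density.differentiableOn one_ne_zero _ hPΩ)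
      (hφd t₀) (fun t ht => hDΩ (hs t ht))
      (fun t ht => (hearly _ (hs t ⟨ht.1, ht.2.le⟩) ht.2).1) hb
    rw [h.density_eq (hΩ _ hPΩ) hPΩ, le_antisymm hb hlim.1] at this
    have hL' := (le_abs_self _).trans ((hL (r₀, t₀) ⟨h0t, htτ, hBr, hrR⟩).trans (le_abs_self L))
    simp only at this hL'
    nlinarith [hφ0 t₀]
  · obtain ⟨s, hst, hs⟩ := hseg (c₁ γ K ρ u (r₀, t₀)) hc0.le (by rw [c₁, c₂]; linarith)
    have hd := (riemann_derivs (K := K) hγ₁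
      (h.contDiffOn_density.differentiableOn one_ne_zero _ hPΩ).hasFDerivWithinAt
      (h.contDiffOn_velocity.differentiableOn one_ne_zero _ hPΩ).hasFDerivWithinAt hρ0).2
    have := directional_nonpos (φ := fun _ => -ε) hst hd.differentiableWithinAt
      (hasDerivAt_const t₀ (-ε)) (fun t ht => hDΩ (hs t ht))
      (fun t ht => (hearly _ (hs t ⟨ht.1, ht.2.le⟩) ht.2).2) hb
    rw [(h.riemann_eq hγ₁ hK (hΩ _ hPΩ) hPΩ hρ0).2.1] at this
    have hr := h.radius_pos _ hPΩ
    have : 0 < m * soundSpeed γ K ρ (r₀, t₀) * u (r₀, t₀) / r₀ := by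
      have : (0 : ℝ) < m := by exact_mod_cast hm
      simp only at hr
      positivity
    simp only at *
    linarith

theorem positivity_of_data {γ K : ℝ} {m : ℕ} {T₀ ρlow : ℝ} {B B' : ℝ → ℝ} {ρ u : ℝ × ℝ → ℝ}
    (hγ₁ : 1 < γ) (hγ₃ : γ < 3) (hK : 0 < K) (hm : 0 < m) (hρlow : 0 < ρlow)
    (h : IsClassicalSolution γ K m (region B T₀) ρ u)
    (hB : ∀ t ∈ Ico 0 T₀, HasDerivWithinAt B (B' t) (Ico 0 T₀) t)
    (h₀ : ∀ x ∈ region B T₀, x.2 = 0 → ρlow ≤ ρ x ∧ 0 ≤ riemannSlow γ K ρ u x)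
    (hside : (∀ t ∈ Ico 0 T₀, B' t = c₂ γ K ρ u (B t, t)) ∨
      ∀ t ∈ Ico 0 T₀, ρlow ≤ ρ (B t, t) ∧ 0 ≤ riemannSlow γ K ρ u (B t, t)) :
    ∀ x ∈ region B T₀, 0 < ρ x ∧ 0 ≤ riemannSlow γ K ρ u x := by
  intro x hx
  have hsub : Icc 0 x.2 ⊆ Ico 0 T₀ := fun t ht => ⟨ht.1, ht.2.trans_lt hx.2.1⟩
  have hBc : ContinuousOn B (Icc 0 x.2) := fun t ht =>
    ((hB t (hsub ht)).continuousWithinAt).mono hsub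
  obtain ⟨M, hM⟩ := (isCompact_Icc.image_of_continuousOn hBc).bddAbove
  obtain ⟨ε₀, hε₀, hbar⟩ := barrier hγ₁ hγ₃ hK hm hρlow h hB h₀ hside (τ := x.2)
    (R := max M x.1) hx.2.1 fun t ht => (hM ⟨t, ht, rfl⟩).trans (le_max_left _ _)
  have hxD : x ∈ trapezoid B x.2 (max M x.1) := ⟨hx.1, le_rfl, hx.2.2, le_max_right _ _⟩
  refine ⟨(hbar ε₀ hε₀ le_rfl x hxD).1, ?_⟩
  by_contra! hneg
  have := (hbar (min ε₀ (-riemannSlow γ K ρ u x)) (lt_min hε₀ (by linarith)) (min_le_left _ _)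
    x hxD).2
  linarith [min_le_right ε₀ (-riemannSlow γ K ρ u x)]

/-! ### The thresholds for the Euler equations -/

/-- The lower bound on the difference of the Riemann invariants that the lower bound on the density
gives. -/
def minGap (γ K ρlow : ℝ) : ℝ :=
  4 / (γ - 1) * (Real.sqrt (K * γ) * ρlow ^ ((γ - 1) / 2))

/-- The bound on the weighted gradient variables on the data. -/
def dataBound (γ K M₀ ρlow : ℝ) : ℝ :=
  M₀ * Real.exp (-((3 - γ) / 4 / ((γ + 1) / 4 - (3 - γ) / 4)) * Real.log (minGap γ K ρlow))

section

variable {γ K : ℝ} {m : ℕ} {b C₀ M₀ ρlow T₀ : ℝ} {B B' : ℝ → ℝ} {ρ u : ℝ × ℝ → ℝ}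

theorem minGap_pos (hγ₁ : 1 < γ) (hK : 0 < K) (hρlow : 0 < ρlow) : 0 < minGap γ K ρlow := by
  have : 0 < γ - 1 := by linarith
  have : 0 < K * γ := by positivity
  rw [minGap]
  positivity

theorem riemann_sub (x : ℝ × ℝ) : riemannFast γ K ρ u x - riemannSlow γ K ρ u x
    = 4 / (γ - 1) * soundSpeed γ K ρ x := by
  rw [riemannFast, riemannSlow]; ring

theorem StateBound.riemann {x : ℝ × ℝ} (h : StateBound γ K C₀ ρ u x) :
    0 ≤ riemannSlow γ K ρ u x ∧ riemannFast γ K ρ u x ≤ 2 * C₀ := by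
  obtain ⟨-, h2, h3⟩ := h
  have e : 2 / (γ - 1) * soundSpeed γ K ρ x
      = 2 * Real.sqrt (K * γ) / (γ - 1) * ρ x ^ ((γ - 1) / 2) := by
    rw [soundSpeed]; ring
  rw [riemannSlow, riemannFast, e]
  constructor <;> linarith

/-- A solution of the Euler equations whose data satisfy the hypotheses yields an admissible
solution of the diagonal system. -/
theorem isAdmissible (hγ₁ : 1 < γ) (hγ₃ : γ < 3) (hK : 0 < K) (hm : 0 < m) (hM₀ : 0 < M₀)
    (hρlow : 0 < ρlow) (h : IsClassicalSolution γ K m (region B T₀) ρ u) (hb : B 0 = b)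
    (hB : ∀ t ∈ Ico 0 T₀, HasDerivWithinAt B (B' t) (Ico 0 T₀) t)
    (hi : InitialHypotheses γ K m b C₀ M₀ ρlow (region B T₀) ρ u)
    (hside : (∀ t ∈ Ico 0 T₀, B' t = c₂ γ K ρ u (B t, t)) ∨
      (∀ t ∈ Ico 0 T₀, B' t = c₁ γ K ρ u (B t, t)) ∧
        BoundaryHypotheses γ K m C₀ M₀ ρlow T₀ B (region B T₀) ρ u) :
    IsAdmissible ((γ + 1) / 4) ((3 - γ) / 4) (m * (γ - 1) / 8) b (2 * C₀)
      (dataBound γ K M₀ ρlow) (minGap γ K ρlow) T₀ B B' (riemannFast γ K ρ u)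
      (riemannSlow γ K ρ u) ∧
    (∀ x ∈ region B T₀, alpha γ K m (region B T₀) ρ u x = grad ((γ + 1) / 4) ((3 - γ) / 4)
      (region B T₀) (riemannFast γ K ρ u) (riemannSlow γ K ρ u) x) ∧
    (∀ x ∈ region B T₀, beta γ K m (region B T₀) ρ u x = grad ((γ + 1) / 4) ((3 - γ) / 4)
      (region B T₀) (riemannSlow γ K ρ u) (riemannFast γ K ρ u) x) := by
  have hg1 : 0 < γ - 1 := by linarith
  have hΩ := uniqueDiffOn_region hB
  have cρ := h.contDiffOn_density.continuousOn
  have cu := h.contDiffOn_velocity.continuousOn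
  have cs : ContinuousOn (soundSpeed γ K ρ) (region B T₀) := continuousOn_soundSpeed hγ₁ cρ
  -- the bounds on the initial state extend to the corner by continuity
  have hstate : ∀ x ∈ region B T₀, x.2 = 0 →
      0 ≤ riemannSlow γ K ρ u x ∧ riemannFast γ K ρ u x ≤ 2 * C₀ := by
    rintro ⟨r, t⟩ ⟨h0, hT, hr⟩ rfl
    simp only [hb] at hr hT
    have hpath : ∀ y ∈ Ici r, ((y, 0) : ℝ × ℝ) ∈ region B T₀ := fun y hy =>
      ⟨le_rfl, hT, by simp only [hb]; exact hr.trans hy⟩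
    have hlim : ∀ f : ℝ × ℝ → ℝ, ContinuousOn f (region B T₀) →
        Tendsto (fun y => f (y, 0)) (𝓝[>] r) (𝓝 (f (r, 0))) := fun f hf =>
      ((hf.comp (continuous_id.prodMk continuous_const).continuousOn hpath) r
        self_mem_Ici).mono_left (nhdsWithin_mono _ Ioi_subset_Ici_self)
    have hev : ∀ᶠ y in 𝓝[>] r, StateBound γ K C₀ ρ u (y, 0) := by
      filter_upwards [self_mem_nhdsWithin] with y hy
      exact hi.state y (hr.trans_lt hy)
    constructor
    · exact ge_of_tendsto (hlim _ (cu.sub (continuousOn_const.mul cs)))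
        (hev.mono fun y hy => hy.riemann.1)
    · exact le_of_tendsto (hlim _ (cu.add (continuousOn_const.mul cs)))
        (hev.mono fun y hy => hy.riemann.2)
  have hdens : ∀ x ∈ region B T₀, x.2 = 0 → ρlow ≤ ρ x := by
    rintro ⟨r, t⟩ ⟨h0, hT, hr⟩ rfl
    simp only [hb] at hr
    exact hi.density r hr
  have hpos := positivity_of_data hγ₁ hγ₃ hK hm hρlow h hB
    (fun x hx h0 => ⟨hdens x hx h0, (hstate x hx h0).1⟩)
    (hside.imp_right fun hs t ht => ⟨hs.2.density t ht, (hs.2.state t ht).riemann.1⟩)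
  have hs0 : ∀ x ∈ region B T₀, 0 < soundSpeed γ K ρ x := fun x hx =>
    soundSpeed_pos hγ₁ hK (hpos x hx).1
  have hlt : ∀ x ∈ region B T₀, riemannSlow γ K ρ u x < riemannFast γ K ρ u x := fun x hx => by
    rw [← sub_pos, riemann_sub]
    exact mul_pos (div_pos (by norm_num) hg1) (hs0 x hx)
  have hα : ∀ x ∈ region B T₀, alpha γ K m (region B T₀) ρ u x = grad ((γ + 1) / 4) ((3 - γ) / 4)
      (region B T₀) (riemannFast γ K ρ u) (riemannSlow γ K ρ u) x := fun x hx => by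
    rw [(h.riemann_eq hγ₁ hK (hΩ x hx) hx (hpos x hx).1).2.2.1, grad, c₂_eq hγ₁]
  have hβ : ∀ x ∈ region B T₀, beta γ K m (region B T₀) ρ u x = grad ((γ + 1) / 4) ((3 - γ) / 4)
      (region B T₀) (riemannSlow γ K ρ u) (riemannFast γ K ρ u) x := fun x hx => by
    rw [(h.riemann_eq hγ₁ hK (hΩ x hx) hx (hpos x hx).1).2.2.2, grad, c₁_eq hγ₁]
  refine ⟨?_, hα, hβ⟩
  have hgap0 := minGap_pos hγ₁ hK hρlow
  have hgap : ∀ x, ρlow ≤ ρ x →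
      minGap γ K ρlow ≤ riemannFast γ K ρ u x - riemannSlow γ K ρ u x := fun x hx => by
    rw [riemann_sub, minGap, soundSpeed]
    gcongr
  have hweight : ∀ (g : ℝ) (x : ℝ × ℝ), g < M₀ → ρlow ≤ ρ x →
      g * weight ((γ + 1) / 4) ((3 - γ) / 4) (riemannFast γ K ρ u) (riemannSlow γ K ρ u) x
        ≤ dataBound γ K M₀ ρlow := by
    intro g x hg hx
    rw [dataBound, weight]
    have hk : 0 < (3 - γ) / 4 / ((γ + 1) / 4 - (3 - γ) / 4) :=
      div_pos (by linarith) (by linarith)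
    have hl := Real.log_le_log hgap0 (hgap x hx)
    refine (mul_le_mul_of_nonneg_right hg.le (Real.exp_pos _).le).trans ?_
    gcongr M₀ * Real.exp ?_
    rw [neg_mul, neg_mul]
    exact neg_le_neg (mul_le_mul_of_nonneg_left hl hk.le)
  have hcw : ContDiffOn ℝ 1 (soundSpeed γ K ρ) (region B T₀) := by
    refine contDiffOn_const.mul (h.contDiffOn_density.rpow_const_of_ne fun x hx => ?_)
    exact (hpos x hx).1.ne'
  have hmem : ∀ t ∈ Ico 0 T₀, (B t, t) ∈ region B T₀ := fun t ht => ⟨ht.1, ht.2, le_rfl⟩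
  have hB0 : ∀ t ∈ Ico 0 T₀, 0 ≤ B' t := by
    have hc : ∀ x ∈ region B T₀, 0 ≤ c₁ γ K ρ u x ∧ 0 ≤ c₂ γ K ρ u x := fun x hx => by
      have h1 := (hpos x hx).2
      have h2 := h1.trans (hlt x hx).le
      have h3 : 0 < 3 - γ := by linarith
      rw [c₁_eq hγ₁, c₂_eq hγ₁]
      constructor <;> positivity
    intro t ht
    rcases hside with hs | hs
    · rw [hs t ht]; exact (hc _ (hmem t ht)).2
    · rw [hs.1 t ht]; exact (hc _ (hmem t ht)).1
  have hBm : MonotoneOn B (Ico 0 T₀) := by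
    have hd : ∀ t ∈ Ioo 0 T₀, HasDerivAt B (B' t) t := fun t ht =>
      (hB t (Ioo_subset_Ico_self ht)).hasDerivAt (Ico_mem_nhds ht.1 ht.2)
    refine monotoneOn_of_deriv_nonneg (convex_Ico _ _)
      (fun t ht => (hB t ht).continuousWithinAt) ?_ ?_
    · rw [interior_Ico]
      exact fun t ht => (hd t ht).differentiableAt.differentiableWithinAt
    · rw [interior_Ico]
      intro t ht
      rw [(hd t ht).deriv]
      exact hB0 t (Ioo_subset_Ico_self ht)
  refine ⟨⟨h.radius_pos, hΩ, ?_, h.contDiffOn_velocity.add (contDiffOn_const.mul hcw),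
    h.contDiffOn_velocity.sub (contDiffOn_const.mul hcw), ?_, ?_⟩, hB, hb,
    fun x hx => (hpos x hx).2, hlt, ?_, ?_⟩
  · rintro r s t ⟨h1, h2, h3⟩ hs hst
    simp only at h1 h2 h3
    exact ⟨hs, hst.trans_lt h2, (hBm ⟨hs, hst.trans_lt h2⟩ ⟨h1, h2⟩ hst).trans h3⟩
  · intro x hx
    rw [← c₂_eq hγ₁, (h.riemann_eq hγ₁ hK (hΩ x hx) hx (hpos x hx).1).1, riemannFast, riemannSlow]
    field_simp; ring
  · intro x hx
    rw [← c₁_eq hγ₁, (h.riemann_eq hγ₁ hK (hΩ x hx) hx (hpos x hx).1).2.1, riemannFast,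
      riemannSlow]
    field_simp; ring
  · intro x hx h0
    have hr : b ≤ x.1 := by rw [← hb, ← h0]; exact hx.2.2
    have e : x = (x.1, 0) := by rw [← h0]
    refine ⟨?_, ?_, hgap x (hdens x hx h0), (hstate x hx h0).2⟩
    · rw [wgrad, ← hα x hx]
      exact hweight _ x (e ▸ hi.alpha_lt x.1 hr) (hdens x hx h0)
    · rw [wgrad, weight_comm, ← hβ x hx]
      exact hweight _ x (e ▸ hi.beta_lt x.1 hr) (hdens x hx h0)
  · rcases hside with hs | hs
    · exact Or.inl fun t ht => by rw [hs t ht, c₂_eq hγ₁]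
    · refine Or.inr ⟨fun t ht => by rw [hs.1 t ht, c₁_eq hγ₁], fun t ht => ⟨?_, ?_, ?_⟩⟩
      · rw [wgrad, ← hα _ (hmem t ht)]
        exact hweight _ _ (hs.2.alpha_lt t ht) (hs.2.density t ht)
      · exact hgap _ (hs.2.density t ht)
      · exact (hs.2.state t ht).riemann.2

end

namespace IsAdmissible

variable {a b κ b₀ W M H T₀ : ℝ} {B B' : ℝ → ℝ} {w z : ℝ × ℝ → ℝ}

theorem speed_le (h : IsAdmissible a b κ b₀ W M H T₀ B B' w z) (hb : 0 < b) (hab : b < a)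
    (hab1 : a + b = 1) (hκ : 0 < κ) {x : ℝ × ℝ} (hx : x ∈ region B T₀) :
    a * w x + b * z x ≤ W ∧ a * z x + b * w x ≤ W := by
  have h1 := h.left_le hb hab hκ x hx
  have h2 := (h.lt x hx).le.trans h1
  have ha := hb.trans hab
  have e : W = a * W + b * W := by rw [← add_mul, hab1, one_mul]
  constructor <;>
    linarith [mul_le_mul_of_nonneg_left h1 ha.le, mul_le_mul_of_nonneg_left h2 ha.le,
      mul_le_mul_of_nonneg_left h1 hb.le, mul_le_mul_of_nonneg_left h2 hb.le]

theorem exists_forward_fast (h : IsAdmissible a b κ b₀ W M H T₀ B B' w z) (hb : 0 < b)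
    (hab : b < a) (hab1 : a + b = 1) (hκ : 0 < κ) {r₁ t₁ t₂ : ℝ}
    (h₁ : (r₁, t₁) ∈ region B T₀) (h₁₂ : t₁ < t₂) (h₂ : t₂ < T₀) :
    ∃ X : ℝ → ℝ, X t₁ = r₁ ∧
      IsCharacteristic (fun x => a * w x + b * z x) (region B T₀) X t₁ t₂ := by
  refine exists_forward_characteristic h.deriv h.contDiffOn_speed.1
    (fun x hx => (h.speed_nonneg (hb.trans hab).le hb.le hx).1)
    (fun x hx => (h.speed_le hb hab hab1 hκ hx).1) h₁ h₁₂ h₂ (Or.inl fun t ht => ?_)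
  rcases h.side with hs | hs
  · exact (hs t ht).le
  · rw [hs.1 t ht]
    exact h.slow_le_fast hab (boundary_mem ht)

theorem exists_forward_slow (h : IsAdmissible a b κ b₀ W M H T₀ B B' w z) (hb : 0 < b)
    (hab : b < a) (hab1 : a + b = 1) (hκ : 0 < κ) {r₁ t₁ t₂ : ℝ}
    (h₁ : (r₁, t₁) ∈ region B T₀) (h₁₂ : t₁ < t₂) (h₂ : t₂ < T₀)
    (hside : (∀ t ∈ Ico 0 T₀, B' t = a * z (B t, t) + b * w (B t, t)) ∨
      W * (t₂ - t₁) ≤ r₁ - B t₁) :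
    ∃ X : ℝ → ℝ, X t₁ = r₁ ∧
      IsCharacteristic (fun x => a * z x + b * w x) (region B T₀) X t₁ t₂ := by
  refine exists_forward_characteristic h.deriv h.contDiffOn_speed.2
    (fun x hx => (h.speed_nonneg (hb.trans hab).le hb.le hx).2)
    (fun x hx => (h.speed_le hb hab hab1 hκ hx).2) h₁ h₁₂ h₂
    (hside.imp (fun hs t ht => (hs t ht).le) fun hfar => ⟨fun t ht => ?_, hfar⟩)
  have hsp := h.speed_le hb hab hab1 hκ (boundary_mem ht)
  rcases h.side with hs | hs
  · rw [hs t ht]; exact hsp.1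
  · rw [hs.1 t ht]; exact hsp.2

end IsAdmissible

end

end RadialEuler

theorem theorem6p1 (γ K : ℝ) (m : ℕ) (b T C₀ M₀ ρlow : ℝ)
    (hγ₁ : 1 < γ) (hγ₃ : γ < 3) (hK : 0 < K) (hm : m = 1 ∨ m = 2)
    (hb : 0 < b) (hT : 0 < T) (hM₀ : 0 < M₀) (hρlow : 0 < ρlow) :
    -- thresholds for compression in the initial data
    (∃ N : ℝ, 0 < N ∧
      (∀ (T₀ : ℝ) (B : ℝ → ℝ) (ρ u : ℝ × ℝ → ℝ),
        RadialEuler.IsSolutionProblem1 γ K m b T₀ B ρ u →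
        RadialEuler.InitialHypotheses γ K m b C₀ M₀ ρlow (RadialEuler.region B T₀) ρ u →
        (∃ r, b ≤ r ∧ RadialEuler.alpha γ K m (RadialEuler.region B T₀) ρ u (r, 0) ≤ -N) →
        T₀ < T) ∧
      (∀ (T₀ : ℝ) (B : ℝ → ℝ) (ρ u : ℝ × ℝ → ℝ),
        RadialEuler.IsSolutionProblem2 γ K m b T₀ B ρ u →
        RadialEuler.InitialHypotheses γ K m b C₀ M₀ ρlow (RadialEuler.region B T₀) ρ u →
        RadialEuler.BoundaryHypotheses γ K m C₀ M₀ ρlow T₀ B (RadialEuler.region B T₀) ρ u →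
        (∃ r, b ≤ r ∧
          min (RadialEuler.alpha γ K m (RadialEuler.region B T₀) ρ u (r, 0))
            (RadialEuler.beta γ K m (RadialEuler.region B T₀) ρ u (r, 0)) ≤ -N) →
        T₀ < T)) ∧
    -- thresholds at distance `δ` from the corner of Problem 1, and at time `δ` before `T`
    (∀ δ : ℝ, 0 < δ → ∃ N : ℝ, 0 < N ∧
      (∀ (T₀ : ℝ) (B : ℝ → ℝ) (ρ u : ℝ × ℝ → ℝ),
        RadialEuler.IsSolutionProblem1 γ K m b T₀ B ρ u →
        RadialEuler.InitialHypotheses γ K m b C₀ M₀ ρlow (RadialEuler.region B T₀) ρ u →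
        (∃ r, b + δ ≤ r ∧
          RadialEuler.beta γ K m (RadialEuler.region B T₀) ρ u (r, 0) ≤ -N) →
        T₀ < T) ∧
      (∀ (T₀ : ℝ) (B : ℝ → ℝ) (ρ u : ℝ × ℝ → ℝ),
        RadialEuler.IsSolutionProblem2 γ K m b T₀ B ρ u →
        RadialEuler.InitialHypotheses γ K m b C₀ M₀ ρlow (RadialEuler.region B T₀) ρ u →
        RadialEuler.BoundaryHypotheses γ K m C₀ M₀ ρlow T₀ B (RadialEuler.region B T₀) ρ u →
        (∃ t ∈ Set.Ico 0 T₀, t ≤ T - δ ∧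
          RadialEuler.alpha γ K m (RadialEuler.region B T₀) ρ u (B t, t) ≤ -N) →
        T₀ < T)) := by
  have hm0 : 0 < m := by omega
  have hq : 0 < (3 - γ) / 4 := by linarith
  have hpq : (3 - γ) / 4 < (γ + 1) / 4 := by linarith
  have hsum : (γ + 1) / 4 + (3 - γ) / 4 = 1 := by ring
  have hκ : 0 < m * (γ - 1) / 8 := by
    have h1 : (0 : ℝ) < m := by exact_mod_cast hm0
    have h2 : 0 < γ - 1 := by linarith
    positivity
  have hH := RadialEuler.minGap_pos hγ₁ hK hρlow
  have hM : 0 < RadialEuler.dataBound γ K M₀ ρlow := mul_pos hM₀ (Real.exp_pos _)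
  have adm₁ : ∀ (T₀ : ℝ) (B : ℝ → ℝ) (ρ u : ℝ × ℝ → ℝ),
      RadialEuler.IsSolutionProblem1 γ K m b T₀ B ρ u →
      RadialEuler.InitialHypotheses γ K m b C₀ M₀ ρlow (RadialEuler.region B T₀) ρ u → _ :=
    fun T₀ B ρ u h hi => RadialEuler.isAdmissible hγ₁ hγ₃ hK hm0 hM₀ hρlow h.solution h.start
      h.characteristic hi (Or.inl fun t _ => rfl)
  have adm₂ : ∀ (T₀ : ℝ) (B : ℝ → ℝ) (ρ u : ℝ × ℝ → ℝ),
      RadialEuler.IsSolutionProblem2 γ K m b T₀ B ρ u →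
      RadialEuler.InitialHypotheses γ K m b C₀ M₀ ρlow (RadialEuler.region B T₀) ρ u →
      RadialEuler.BoundaryHypotheses γ K m C₀ M₀ ρlow T₀ B (RadialEuler.region B T₀) ρ u → _ :=
    fun T₀ B ρ u h hi hbd => RadialEuler.isAdmissible hγ₁ hγ₃ hK hm0 hM₀ hρlow h.solution h.start
      h.characteristic hi (Or.inr ⟨fun t _ => rfl, hbd⟩)
  constructor
  · obtain ⟨N, hN, hthr⟩ := RadialEuler.exists_threshold (W := 2 * C₀) (T := T) (η := T / 2)
      hq hpq hsum hκ hb hM hH (by linarith)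
    refine ⟨N, hN, ?_, ?_⟩
    · rintro T₀ B ρ u h hi ⟨r, hr, hle⟩
      by_contra! hTT
      obtain ⟨had, hα, hβ⟩ := adm₁ T₀ B ρ u h hi
      have hmem : ((r, 0) : ℝ × ℝ) ∈ RadialEuler.region B T₀ :=
        ⟨le_rfl, hT.trans_le hTT, by simp only [h.start]; exact hr⟩
      obtain ⟨X, hX0, hX⟩ := had.exists_forward_fast hq hpq hsum hκ (t₂ := 0 + T / 2) hmem
        (by linarith) (by linarith)
      have := (hthr T₀ B _ _ _ had X 0 le_rfl (by linarith)).1 hX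
      rw [hX0, ← hα _ hmem] at this
      linarith
    · rintro T₀ B ρ u h hi hbd ⟨r, hr, hle⟩
      by_contra! hTT
      obtain ⟨had, hα, hβ⟩ := adm₂ T₀ B ρ u h hi hbd
      have hmem : ((r, 0) : ℝ × ℝ) ∈ RadialEuler.region B T₀ :=
        ⟨le_rfl, hT.trans_le hTT, by simp only [h.start]; exact hr⟩
      rcases min_le_iff.1 hle with hle | hle
      · obtain ⟨X, hX0, hX⟩ := had.exists_forward_fast hq hpq hsum hκ (t₂ := 0 + T / 2) hmem
          (by linarith) (by linarith)
        have := (hthr T₀ B _ _ _ had X 0 le_rfl (by linarith)).1 hX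
        rw [hX0, ← hα _ hmem] at this
        linarith
      · obtain ⟨X, hX0, hX⟩ := had.exists_forward_slow hq hpq hsum hκ (t₂ := 0 + T / 2) hmem
          (by linarith) (by linarith) (Or.inl fun t _ => RadialEuler.c₁_eq hγ₁ _)
        have := (hthr T₀ B _ _ _ had X 0 le_rfl (by linarith)).2 hX
        rw [hX0, ← hβ _ hmem] at this
        linarith
  · intro δ hδ
    -- slow characteristics that start at distance `δ` from the corner stay in the domain of
    -- Problem 1 for the time `η`, because the speed of the lateral boundary is at most `2 C₀`
    set η := min (T / 2) (δ / (|2 * C₀| + 1)) with hη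
    have hη0 : 0 < η := lt_min (by linarith) (by positivity)
    have hηT : η ≤ T / 2 := min_le_left _ _
    have hηδ : 2 * C₀ * η ≤ δ := by
      calc 2 * C₀ * η ≤ (|2 * C₀| + 1) * η := by
            gcongr; linarith [le_abs_self (2 * C₀)]
        _ ≤ (|2 * C₀| + 1) * (δ / (|2 * C₀| + 1)) := by gcongr; exact min_le_right _ _
        _ = δ := by field_simp
    obtain ⟨N₁, hN₁, hthr₁⟩ := RadialEuler.exists_threshold (W := 2 * C₀) (T := T) (η := η)
      hq hpq hsum hκ hb hM hH hη0
    obtain ⟨N₂, hN₂, hthr₂⟩ := RadialEuler.exists_threshold (W := 2 * C₀) (T := T) (η := δ / 2)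
      hq hpq hsum hκ hb hM hH (by linarith)
    refine ⟨max N₁ N₂, lt_max_of_lt_left hN₁, ?_, ?_⟩
    · rintro T₀ B ρ u h hi ⟨r, hr, hle⟩
      by_contra! hTT
      obtain ⟨had, hα, hβ⟩ := adm₁ T₀ B ρ u h hi
      have hmem : ((r, 0) : ℝ × ℝ) ∈ RadialEuler.region B T₀ :=
        ⟨le_rfl, hT.trans_le hTT, by simp only [h.start]; linarith⟩
      obtain ⟨X, hX0, hX⟩ := had.exists_forward_slow hq hpq hsum hκ (t₂ := 0 + η) hmem
        (by linarith) (by linarith) (Or.inr (by rw [h.start]; linarith))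
      have := (hthr₁ T₀ B _ _ _ had X 0 le_rfl (by linarith)).2 hX
      rw [hX0, ← hβ _ hmem] at this
      linarith [le_max_left N₁ N₂]
    · rintro T₀ B ρ u h hi hbd ⟨t, ht, htδ, hle⟩
      by_contra! hTT
      obtain ⟨had, hα, hβ⟩ := adm₂ T₀ B ρ u h hi hbd
      have hmem : ((B t, t) : ℝ × ℝ) ∈ RadialEuler.region B T₀ := ⟨ht.1, ht.2, le_rfl⟩
      obtain ⟨X, hX0, hX⟩ := had.exists_forward_fast hq hpq hsum hκ (t₂ := t + δ / 2) hmem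
        (by linarith) (by linarith)
      have := (hthr₂ T₀ B _ _ _ had X t ht.1 (by linarith)).1 hX
      rw [hX0, ← hα _ hmem] at this
      linarith [le_max_right N₁ N₂]
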